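/- Let $d\in\mathbb{N}$ and let $(M_p)_{p\in\mathbb{N}_0}$ be a sequence of positive numbers, monotonically increasing to infinity, with $M_0=1$, which satisfies - $(M.1)$: $M_p^2\le M_{p-1}M_{p+1}$ for $p\ge 1$; - $(M.2)$: there are $A,H>0$ with $M_{p+q}\le AH^{p+q}M_pM_q$ for all $p,q\in\mathbb{N}_0$; - $(M.3)'$: $\sum_{p\ge1}M_{p-1}/M_p<\infty$. Let $M(\rho)=\sup_{p\in\mathbb{N}_0}\ln_+(\rho^p/M_p)$ be its associated function, where $\ln_+t=\max\{\ln t,0\}$ (and $\ln_+0=0$). Let $\omega\in\mathcal{M}_{M(\rho)}(\mathbb{R}^{2d})$, i.e. $\omega\in L^\infty_{loc}(\mathbb{R}^{2d})$ is a nonnegative function for which there is $C>0$ with $\omega(z+w)\le Ce^{M(|z|)}\omega(w)$ for all $z,w\in\mathbb{R}^{2d}$. Let $\mathcal{E}^{(M_p)}(\mathbb{R}^d)$ be the space of all $g\in C^\infty(\mathbb{R}^d)$ such that $\sup_{\alpha\in\mathbb{N}_0^d}\sup_{x\in K}\frac{A^{|\alpha|}}{M_{|\alpha|}}|\partial^\alpha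 g(x)|<\infty$ for every compact $K\subset\mathbb{R}^d$ and every $A>0$. Let $\mathcal{D}^{(M_p)}(\mathbb{R}^d)$ be the space of its compactly supported elements, with its inductive limit topology, and let $(\mathcal{D}^{(M_p)})'(\mathbb{R}^d)$ be the space of continuous linear functionals on it. Let $\mathcal{S}^{(M_p)}(\mathbb{R}^d)$ be the space of all $\phi\in C^\infty(\mathbb{R}^d)$ such that for all $A,B>0$ there is $C>0$ with $\|x^\alpha\partial^\beta\phi\|_{L^\infty}\le CA^{|\alpha|}M_{|\alpha|}B^{|\beta|}M_{|\beta|}$ for all $\alpha,\beta\in\mathbb{N}_0^d$. For $f\in(\mathcal{D}^{(M_p)})'(\mathbb{R}^d)$, $\chi\in\mathcal{D}^{(M_p)}(\mathbb{R}^d)$ and $\phi\in\mathcal{S}^{(M_p)}(\mathbb{R}^d)\setminus 0$, let $\chi f$ be the linear functional $g\mapsto f(\chi g)$ on $\mathcal{E}^{(M_p)}(\mathbb{R}^d)$, and let $$V_\phi(\chi f)(x,\xi)=(2\pi)^{-d/2}\,(\chi f)\big(\overline{\phi(\cdot-x)}\,e^{-i\langle\xi,\cdot\rangle}\big),\qquad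 x,\xi\in\mathbb{R}^d,$$ be its short-time Fourier transform. For $p,q\in[1,\infty]$ and an open cone $\Gamma\subseteq\mathbb{R}^d\setminus 0$ put, with $u=\chi f$, $$|u|_{\mathcal{B}(\phi,\Gamma)}=\Big(\int_\Gamma\Big(\int_{\mathbb{R}^d}|V_\phi u(x,\xi)\,\omega(x,\xi)|^p\,dx\Big)^{q/p}d\xi\Big)^{1/q}\in[0,\infty],\qquad \mathcal{B}=M^{p,q}_{(\omega)},$$ with the usual essential suprema if $p=\infty$ or $q=\infty$. Let $\Theta_{\mathcal{B}}(u)$ be the set of all $\xi\in\mathbb{R}^d\setminus 0$ which have an open conical neighborhood $\Gamma\subseteq\mathbb{R}^d\setminus 0$ such that $|u|_{\mathcal{B}(\phi,\Gamma)}<\infty$, and let $\Sigma_{\mathcal{B}}(u)=(\mathbb{R}^d\setminus 0)\setminus\Theta_{\mathcal{B}}(u)$. The wave-front set $\mathrm{WF}_{M^{p,q}_{(\omega)}}(f)$ is the set of all $(x_0,\xi_0)\in\mathbb{R}^d\times(\mathbb{R}^d\setminus 0)$ such that $\xi_0\in\Sigma_{\mathcal{B}}(\chi f)$ for every $\chi\in\mathcal{D}^{(M_p)}(\mathbb{R}^d)$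 with $\chi(x_0)\ne 0$. **Proposition.** Let $f\in(\mathcal{D}^{(M_p)})'(\mathbb{R}^d)$ and $q\in[1,\infty]$. Then $\mathrm{WF}_{M^{p,q}_{(\omega)}}(f)$ depends neither on $p\in[1,\infty]$ nor on the window $\phi\in\mathcal{S}^{(M_p)}(\mathbb{R}^d)\setminus 0$: for all $p_1,p_2\in[1,\infty]$ and all $\phi_1,\phi_2\in\mathcal{S}^{(M_p)}(\mathbb{R}^d)\setminus 0$, the set $\mathrm{WF}_{M^{p_1,q}_{(\omega)}}(f)$ computed with the window $\phi_1$ equals the set $\mathrm{WF}_{M^{p_2,q}_{(\omega)}}(f)$ computed with the window $\phi_2$. -/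

import Mathlib

open scoped ENNReal NNReal ComplexConjugate

noncomputable section

namespace UltraWF

/-- A positive sequence `(M_p)`, nondecreasing and tending to infinity, with `M_0 = 1`, satisfying
Komatsu's conditions `(M.1)`, `(M.2)` and `(M.3)'`.  (As `M_p ≥ M_0 = 1`, the numbers `M_p ^ (1/p)`
are automatically bounded below by a positive constant.) -/
structure WeightSequence where
  seq : ℕ → ℝ
  pos : ∀ p, 0 < seq p
  mono : Monotone seq
  tendsto_atTop : Filter.Tendsto seq Filter.atTop Filter.atTop
  zero : seq 0 = 1
  /-- `(M.1)`, written at the index `p + 1`. -/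
  logConvex : ∀ p, seq (p + 1) ^ 2 ≤ seq p * seq (p + 2)
  /-- `(M.2)` -/
  stable : ∃ A H : ℝ, 0 < A ∧ 0 < H ∧ ∀ p q, seq (p + q) ≤ A * H ^ (p + q) * seq p * seq q
  /-- `(M.3)'` -/
  nonQuasianalytic : Summable fun p => seq p / seq (p + 1)

namespace WeightSequence

variable (M : WeightSequence)

/-- The associated function `M(ρ) = sup_p ln₊ (ρ^p M_0 / M_p)`.  The supremum is finite
(`M.bddAbove_assoc` below). -/
def assoc (ρ : ℝ) : ℝ := ⨆ p : ℕ, Real.posLog (ρ ^ p * M.seq 0 / M.seq p)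

lemma seq_mul_le (i j : ℕ) : M.seq i * M.seq j ≤ M.seq (i + j) := by
  have hr : Monotone fun n => M.seq (n + 1) / M.seq n := by
    refine monotone_nat_of_le_succ fun n => ?_
    rw [div_le_div_iff₀ (M.pos _) (M.pos _)]
    nlinarith [M.logConvex n]
  induction j with
  | zero => simp [M.zero]
  | succ j ih =>
    have h1 : M.seq (j + 1) = M.seq j * (M.seq (j + 1) / M.seq j) := by
      field_simp [(M.pos j).ne']
    have h2 : M.seq (i + (j + 1)) = M.seq (i + j) * (M.seq (i + j + 1) / M.seq (i + j)) := by
      field_simp [(M.pos (i + j)).ne']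
      rfl
    rw [h1, h2, ← mul_assoc]
    exact mul_le_mul ih (hr (Nat.le_add_left j i)) (div_nonneg (M.pos _).le (M.pos _).le)
      (M.pos _).le

lemma exists_pow_le {R : ℝ} (hR : 0 < R) : ∃ C : ℝ, 0 ≤ C ∧ ∀ n, R ^ n ≤ C * M.seq n := by
  have ht : Filter.Tendsto (fun n => ‖R ^ (n + 1) / M.seq (n + 1)‖ / ‖R ^ n / M.seq n‖)
      Filter.atTop (nhds 0) := by
    have h := (M.nonQuasianalytic.tendsto_atTop_zero).const_mul R
    rw [mul_zero] at h
    refine h.congr fun n => ?_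
    have h1 := M.pos n
    have h2 := M.pos (n + 1)
    rw [Real.norm_of_nonneg (by positivity), Real.norm_of_nonneg (by positivity)]
    field_simp
    ring
  have hs : Summable fun n => R ^ n / M.seq n :=
    summable_of_ratio_test_tendsto_lt_one zero_lt_one
      (Filter.Eventually.of_forall fun n => (div_pos (pow_pos hR n) (M.pos n)).ne') ht
  obtain ⟨C, hC⟩ := hs.tendsto_atTop_zero.bddAbove_range
  refine ⟨max C 0, le_max_right _ _, fun n => ?_⟩
  rw [← div_le_iff₀ (M.pos n)]
  exact (hC ⟨n, rfl⟩).trans (le_max_left _ _)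

lemma bddAbove_assoc (ρ : ℝ) (hρ : 0 < ρ) :
    BddAbove (Set.range fun p : ℕ => Real.posLog (ρ ^ p * M.seq 0 / M.seq p)) := by
  obtain ⟨C, hC0, hC⟩ := M.exists_pow_le hρ
  refine ⟨Real.posLog C, ?_⟩
  rintro _ ⟨p, rfl⟩
  have h1 := M.pos p
  refine Real.posLog_le_posLog (by rw [M.zero]; positivity) ?_
  rw [M.zero, mul_one, div_le_iff₀ h1]
  exact hC p

end WeightSequence

/-- The space `ℝ^d` with its Euclidean norm. -/
abbrev Sp (d : ℕ) := EuclideanSpace ℝ (Fin d)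

variable {d : ℕ} (M : WeightSequence)

/-- The norm `‖g‖_{M,A,K} = sup_n sup_{x ∈ K} (A ^ n / M_n) |g^{(n)}(x)|`, with values in `[0,∞]`.
All derivatives of order `n` are measured together, through the norm of the `n`-th Fréchet
derivative; this differs from the maximum over the multi-indices of length `n` by at most a
factor `d ^ n`, which is absorbed in `A`. -/
def ultraNorm (A : ℝ) (K : Set (Sp d)) (g : Sp d → ℂ) : ℝ≥0∞ :=
  ⨆ (n : ℕ) (x ∈ K), ENNReal.ofReal (A ^ n / M.seq n * ‖iteratedFDeriv ℝ n g x‖)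

/-- Membership in the space `ℰ^{(M_p)}(ℝ^d)` of ultradifferentiable functions of Beurling type. -/
def IsUltraDiff (g : Sp d → ℂ) : Prop :=
  ContDiff ℝ (⊤ : ℕ∞) g ∧ ∀ K : Set (Sp d), IsCompact K → ∀ A : ℝ, 0 < A → ultraNorm M A K g < ∞

lemma ultraNorm_lt_top_iff {A : ℝ} {K : Set (Sp d)} {g : Sp d → ℂ} :
    ultraNorm M A K g < ∞ ↔
      ∃ C : ℝ, 0 ≤ C ∧ ∀ n, ∀ x ∈ K, A ^ n * ‖iteratedFDeriv ℝ n g x‖ ≤ C * M.seq n := by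
  constructor
  · intro h
    refine ⟨(ultraNorm M A K g).toReal, ENNReal.toReal_nonneg, fun n x hx => ?_⟩
    have h1 : ENNReal.ofReal (A ^ n / M.seq n * ‖iteratedFDeriv ℝ n g x‖) ≤ ultraNorm M A K g :=
      le_iSup_of_le n (le_iSup₂_of_le x hx le_rfl)
    have h2 := (ENNReal.ofReal_le_iff_le_toReal h.ne).1 h1
    rwa [div_mul_eq_mul_div, div_le_iff₀ (M.pos n)] at h2
  · rintro ⟨C, -, h⟩
    refine lt_of_le_of_lt ?_ (ENNReal.ofReal_lt_top (r := C))
    refine iSup_le fun n => iSup₂_le fun x hx => ENNReal.ofReal_le_ofReal ?_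
    rw [div_mul_eq_mul_div, div_le_iff₀ (M.pos n)]
    exact h n x hx

lemma isUltraDiff_iff {g : Sp d → ℂ} : IsUltraDiff M g ↔ ContDiff ℝ (⊤ : ℕ∞) g ∧
    ∀ K : Set (Sp d), IsCompact K → ∀ A : ℝ, 0 < A →
      ∃ C : ℝ, 0 ≤ C ∧ ∀ n, ∀ x ∈ K, A ^ n * ‖iteratedFDeriv ℝ n g x‖ ≤ C * M.seq n := by
  unfold IsUltraDiff
  refine and_congr_right fun _ => forall_congr' fun K => forall_congr' fun _ =>
    forall_congr' fun A => forall_congr' fun _ => ultraNorm_lt_top_iff M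

variable {M}

lemma IsUltraDiff.add {f g : Sp d → ℂ} (hf : IsUltraDiff M f) (hg : IsUltraDiff M g) :
    IsUltraDiff M (f + g) := by
  rw [isUltraDiff_iff] at *
  refine ⟨hf.1.add hg.1, fun K hK A hA => ?_⟩
  obtain ⟨C₁, h₁, H₁⟩ := hf.2 K hK A hA
  obtain ⟨C₂, h₂, H₂⟩ := hg.2 K hK A hA
  refine ⟨C₁ + C₂, by positivity, fun n x hx => ?_⟩
  have h := iteratedFDeriv_add_apply (𝕜 := ℝ) (i := n) (x := x)
    (hf.1.of_le (mod_cast le_top)).contDiffAt (hg.1.of_le (mod_cast le_top)).contDiffAt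
  rw [h, add_mul]
  calc _ ≤ A ^ n * (‖iteratedFDeriv ℝ n f x‖ + ‖iteratedFDeriv ℝ n g x‖) := by
        gcongr; exact norm_add_le _ _
    _ ≤ _ := by rw [mul_add]; exact add_le_add (H₁ n x hx) (H₂ n x hx)

lemma IsUltraDiff.mul {f g : Sp d → ℂ} (hf : IsUltraDiff M f) (hg : IsUltraDiff M g) :
    IsUltraDiff M (f * g) := by
  rw [isUltraDiff_iff] at *
  refine ⟨hf.1.mul hg.1, fun K hK A hA => ?_⟩
  obtain ⟨C₁, h₁, H₁⟩ := hf.2 K hK (2 * A) (by positivity)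
  obtain ⟨C₂, h₂, H₂⟩ := hg.2 K hK (2 * A) (by positivity)
  refine ⟨C₁ * C₂, by positivity, fun n x hx => ?_⟩
  have h := norm_iteratedFDeriv_mul_le (𝕜 := ℝ) hf.1 hg.1 x (n := n) (mod_cast le_top)
  have key : (2 * A) ^ n * ‖iteratedFDeriv ℝ n (f * g) x‖ ≤ 2 ^ n * (C₁ * C₂ * M.seq n) := by
    calc (2 * A) ^ n * ‖iteratedFDeriv ℝ n (f * g) x‖
        ≤ (2 * A) ^ n * ∑ i ∈ Finset.range (n + 1), (n.choose i : ℝ) *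
          ‖iteratedFDeriv ℝ i f x‖ * ‖iteratedFDeriv ℝ (n - i) g x‖ := by
          gcongr; exact h
      _ ≤ ∑ i ∈ Finset.range (n + 1), (n.choose i : ℝ) * (C₁ * C₂ * M.seq n) := by
          rw [Finset.mul_sum]
          refine Finset.sum_le_sum fun i hi => ?_
          have hin : i + (n - i) = n := by
            have := Finset.mem_range.1 hi
            omega
          have e : (2 * A) ^ n = (2 * A) ^ i * (2 * A) ^ (n - i) := by rw [← pow_add, hin]
          have hM := M.seq_mul_le i (n - i)
          rw [hin] at hM
          calc _ = (n.choose i : ℝ) * (((2 * A) ^ i * ‖iteratedFDeriv ℝ i f x‖) *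
                ((2 * A) ^ (n - i) * ‖iteratedFDeriv ℝ (n - i) g x‖)) := by rw [e]; ring
            _ ≤ (n.choose i : ℝ) * ((C₁ * M.seq i) * (C₂ * M.seq (n - i))) := by
                have := M.pos i
                exact mul_le_mul_of_nonneg_left (mul_le_mul (H₁ i x hx) (H₂ (n - i) x hx)
                  (by positivity) (by positivity)) (by positivity)
            _ = (n.choose i : ℝ) * (C₁ * C₂ * (M.seq i * M.seq (n - i))) := by ring
            _ ≤ _ := by gcongr
      _ = 2 ^ n * (C₁ * C₂ * M.seq n) := by
          rw [← Finset.sum_mul]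
          congr 1
          exact_mod_cast Nat.sum_range_choose n
  rw [mul_pow, mul_assoc] at key
  exact le_of_mul_le_mul_left key (by positivity)

lemma isUltraDiff_const (c : ℂ) : IsUltraDiff M (fun _ : Sp d => c) := by
  rw [isUltraDiff_iff]
  refine ⟨contDiff_const, fun K hK A hA => ⟨‖c‖, norm_nonneg _, fun n x hx => ?_⟩⟩
  rcases Nat.eq_zero_or_pos n with rfl | hn
  · simp [M.zero]
  · rw [iteratedFDeriv_const_of_ne hn.ne']
    have := M.pos n
    simp only [Pi.zero_apply, norm_zero, mul_zero]
    positivity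

lemma IsUltraDiff.smul {g : Sp d → ℂ} (c : ℂ) (hg : IsUltraDiff M g) :
    IsUltraDiff M (c • g) :=
  (isUltraDiff_const c).mul hg

lemma IsUltraDiff.conj_comp {g : Sp d → ℂ} (hg : IsUltraDiff M g) :
    IsUltraDiff M (fun y => conj (g y)) := by
  rw [isUltraDiff_iff] at *
  refine ⟨Complex.conjCLE.contDiff.comp hg.1, fun K hK A hA => ?_⟩
  obtain ⟨C, h, H⟩ := hg.2 K hK A hA
  refine ⟨C, h, fun n x hx => ?_⟩
  have e := LinearIsometryEquiv.norm_iteratedFDeriv_comp_left (𝕜 := ℝ) Complex.conjLIE g x n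
  have e' : (fun y => conj (g y)) = Complex.conjLIE ∘ g := rfl
  rw [e', e]
  exact H n x hx

lemma IsUltraDiff.comp_sub {g : Sp d → ℂ} (hg : IsUltraDiff M g) (a : Sp d) :
    IsUltraDiff M (fun y => g (y - a)) := by
  rw [isUltraDiff_iff] at *
  refine ⟨hg.1.comp (contDiff_id.sub contDiff_const), fun K hK A hA => ?_⟩
  obtain ⟨C, h, H⟩ := hg.2 ((fun y => y - a) '' K)
    (hK.image (continuous_id.sub continuous_const)) A hA
  refine ⟨C, h, fun n x hx => ?_⟩
  rw [iteratedFDeriv_comp_sub]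
  exact H n _ ⟨x, hx, rfl⟩

lemma isUltraDiff_exp (ξ : Sp d) :
    IsUltraDiff M (fun y : Sp d => Complex.exp (-Complex.I * (inner ℝ ξ y : ℝ))) := by
  set h : ℝ → ℂ := fun t => Complex.exp (-Complex.I * (t : ℂ)) with hh
  have hsm : ContDiff ℝ (⊤ : ℕ∞) h := by
    rw [hh]; exact (contDiff_const.mul Complex.ofRealCLM.contDiff).cexp
  have hder : ∀ n : ℕ, iteratedDeriv n h = fun t : ℝ => (-Complex.I) ^ n * h t := by
    intro n
    induction n with
    | zero => simp
    | succ n ih =>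
      rw [iteratedDeriv_succ, ih]
      funext t
      have h1 : HasDerivAt (fun t : ℝ => -Complex.I * (t : ℂ)) (-Complex.I) t := by
        simpa using (Complex.ofRealCLM.hasDerivAt (x := t)).const_mul (-Complex.I)
      have h2 := (h1.cexp).const_mul ((-Complex.I) ^ n)
      rw [HasDerivAt.deriv h2, hh]
      ring
  have hnorm : ∀ n t, ‖iteratedFDeriv ℝ n h t‖ ≤ 1 := by
    intro n t
    rw [norm_iteratedFDeriv_eq_norm_iteratedDeriv, hder]
    simp [hh, Complex.norm_exp]
  have e : (fun y : Sp d => Complex.exp (-Complex.I * (inner ℝ ξ y : ℝ))) =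
      h ∘ (innerSL ℝ ξ : Sp d →L[ℝ] ℝ) := by
    funext y; simp [hh]
  rw [e, isUltraDiff_iff]
  refine ⟨hsm.comp (innerSL ℝ ξ).contDiff, fun K hK A hA => ?_⟩
  obtain ⟨C, hC0, hC⟩ := M.exists_pow_le (R := A * (‖ξ‖ + 1)) (by positivity)
  refine ⟨C, hC0, fun n x hx => le_trans ?_ (hC n)⟩
  rw [ContinuousLinearMap.iteratedFDeriv_comp_right _ hsm x (mod_cast le_top), mul_pow]
  gcongr
  refine (ContinuousMultilinearMap.norm_compContinuousLinearMap_le _ _).trans ?_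
  rw [Finset.prod_const, Finset.card_univ, Fintype.card_fin, innerSL_apply_norm]
  calc _ ≤ 1 * ‖ξ‖ ^ n := by gcongr; exact hnorm n _
    _ ≤ (‖ξ‖ + 1) ^ n := by rw [one_mul]; gcongr; linarith

variable (M d)

/-- The space `ℰ^{(M_p)}(ℝ^d)`. -/
def UltraE : Submodule ℂ (Sp d → ℂ) where
  carrier := {g | IsUltraDiff M g}
  add_mem' := fun hf hg => hf.add hg
  zero_mem' := isUltraDiff_const 0
  smul_mem' := fun c _ hg => hg.smul c

/-- The space `𝒟^{(M_p)}(ℝ^d)`: the compactly supported elements of `ℰ^{(M_p)}(ℝ^d)`. -/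
def UltraD : Submodule ℂ (Sp d → ℂ) where
  carrier := {g | IsUltraDiff M g ∧ HasCompactSupport g}
  add_mem' := fun hf hg => ⟨hf.1.add hg.1, hf.2.add hg.2⟩
  zero_mem' := ⟨isUltraDiff_const 0, HasCompactSupport.zero⟩
  smul_mem' := fun c _ hg => ⟨hg.1.smul c, hg.2.smul_left (f := fun _ => c)⟩

/-- The space `(𝒟^{(M_p)})'(ℝ^d)` of ultradistributions of Beurling type: the linear functionals
on `𝒟^{(M_p)}(ℝ^d)` that are continuous for its inductive limit topology, i.e. that are continuous
on the Fréchet space of the test functions supported in `K`, for every compact `K`. -/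
structure Ultradistribution where
  toLin : UltraD d M →ₗ[ℂ] ℂ
  continuous' : ∀ K : Set (Sp d), IsCompact K → ∃ A : ℝ, 0 < A ∧ ∃ C : ℝ≥0,
    ∀ g : UltraD d M, tsupport (g : Sp d → ℂ) ⊆ K →
      ENNReal.ofReal ‖toLin g‖ ≤ C * ultraNorm M A K (g : Sp d → ℂ)

variable {d}

/-- Membership in the Gelfand–Shilov space `𝒮^{(M_p)}(ℝ^d) = Σ^{M_p}_{M_p}(ℝ^d)`.  As in
`ultraNorm`, Euclidean and operator norms replace the maxima over multi-indices of given length,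
which only changes `A` and `B` by constant factors. -/
def IsGelfandShilov (φ : Sp d → ℂ) : Prop :=
  ContDiff ℝ (⊤ : ℕ∞) φ ∧ ∀ A B : ℝ, 0 < A → 0 < B → ∃ C : ℝ, ∀ (m n : ℕ) (x : Sp d),
    ‖x‖ ^ m * ‖iteratedFDeriv ℝ n φ x‖ ≤ C * (A ^ m * M.seq m) * (B ^ n * M.seq n)

variable {M}

lemma IsGelfandShilov.isUltraDiff {φ : Sp d → ℂ} (h : IsGelfandShilov M φ) :
    IsUltraDiff M φ := by
  rw [isUltraDiff_iff]
  refine ⟨h.1, fun K hK A hA => ?_⟩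
  obtain ⟨C, hC⟩ := h.2 1 A⁻¹ one_pos (inv_pos.2 hA)
  refine ⟨max C 0, le_max_right _ _, fun n x hx => ?_⟩
  have h1 := hC 0 n x
  have := M.pos n
  simp only [pow_zero, one_mul, M.zero, mul_one] at h1
  calc A ^ n * ‖iteratedFDeriv ℝ n φ x‖ ≤ A ^ n * (C * (A⁻¹ ^ n * M.seq n)) := by gcongr
    _ = C * M.seq n := by rw [inv_pow]; field_simp
    _ ≤ _ := by gcongr; exact le_max_left _ _

/-- The localization `χ f` of `f ∈ (𝒟^{(M_p)})'` by `χ ∈ 𝒟^{(M_p)}`, as a linear functional on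
`ℰ^{(M_p)}`: `(χ f)(g) = f(χ g)`. -/
def localize (f : Ultradistribution d M) (χ : UltraD d M) : UltraE d M →ₗ[ℂ] ℂ where
  toFun g := f.toLin ⟨(χ : Sp d → ℂ) * (g : Sp d → ℂ), χ.2.1.mul g.2, χ.2.2.mul_right⟩
  map_add' g h := by
    rw [← map_add]; congr 1; ext y; simp [mul_add]
  map_smul' c g := by
    rw [RingHom.id_apply, ← map_smul]; congr 1; ext y; simp [mul_left_comm]

/-- The function `y ↦ conj (φ (y - x)) e^{-i⟨ξ,y⟩}`, an element of `ℰ^{(M_p)}`. -/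
def stftAtom (φ : Sp d → ℂ) (hφ : IsGelfandShilov M φ) (x ξ : Sp d) : UltraE d M :=
  ⟨fun y => conj (φ (y - x)) * Complex.exp (-Complex.I * (inner ℝ ξ y : ℝ)),
    ((hφ.isUltraDiff.comp_sub x).conj_comp).mul (isUltraDiff_exp ξ)⟩

/-- The short-time Fourier transform `V_φ u (x, ξ) = (2π)^{-d/2} u(conj φ(· - x) e^{-i⟨ξ,·⟩})`,
i.e. `(2π)^{-d/2} ∫ u(y) conj (φ(y - x)) e^{-i⟨ξ,y⟩} dy` when `u` is a function. -/
def stft (φ : Sp d → ℂ) (hφ : IsGelfandShilov M φ) (u : UltraE d M →ₗ[ℂ] ℂ) (x ξ : Sp d) : ℂ :=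
  ((2 * Real.pi) ^ (-(d : ℝ) / 2) : ℝ) * u (stftAtom φ hφ x ξ)

variable (M)

/-- `ω ∈ ℳ_{M(ρ)}(ℝ^{2d})`: `ω` is a weight (nonnegative, in `L^∞_loc`), moderate with respect to
`z ↦ e^{M(|z|)}`, where `|(x,ξ)|` is the Euclidean norm of `ℝ^{2d}`. -/
structure IsModerateWeight (ω : Sp d × Sp d → ℝ) : Prop where
  nonneg : ∀ z, 0 ≤ ω z
  aestronglyMeasurable : MeasureTheory.AEStronglyMeasurable ω MeasureTheory.volume
  locBounded : ∀ K : Set (Sp d × Sp d), IsCompact K →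
    MeasureTheory.eLpNorm ω ∞ (MeasureTheory.volume.restrict K) < ∞
  moderate : ∃ C : ℝ, 0 < C ∧ ∀ z w : Sp d × Sp d,
    ω (z + w) ≤ C * Real.exp (M.assoc (Real.sqrt (‖z.1‖ ^ 2 + ‖z.2‖ ^ 2))) * ω w

variable {M}

/-- Open cones in `ℝ^d \ 0`. -/
def IsOpenCone (Γ : Set (Sp d)) : Prop :=
  IsOpen Γ ∧ (0 : Sp d) ∉ Γ ∧ ∀ ξ ∈ Γ, ∀ t : ℝ, 0 < t → t • ξ ∈ Γ

/-- The quantity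
`|u|_{ℬ(φ,Γ)} = (∫_Γ (∫ |V_φ u(x,ξ) ω(x,ξ)|^p dx)^{q/p} dξ)^{1/q} ∈ [0,∞]`, `ℬ = M^{p,q}_{(ω)}`,
with the essential supremum in place of an integral when `p` or `q` is `∞`. -/
def coneSeminorm (p q : ℝ≥0∞) (ω : Sp d × Sp d → ℝ) (φ : Sp d → ℂ) (hφ : IsGelfandShilov M φ)
    (Γ : Set (Sp d)) (u : UltraE d M →ₗ[ℂ] ℂ) : ℝ≥0∞ :=
  MeasureTheory.eLpNorm (fun ξ => MeasureTheory.eLpNorm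
      (fun x => stft φ hφ u x ξ * (ω (x, ξ) : ℂ)) p MeasureTheory.volume)
    q (MeasureTheory.volume.restrict Γ)

/-- `Θ_ℬ(u)`: the directions `ξ ≠ 0` with an open conical neighborhood `Γ` such that
`|u|_{ℬ(φ,Γ)} < ∞`. -/
def regularDirections (p q : ℝ≥0∞) (ω : Sp d × Sp d → ℝ) (φ : Sp d → ℂ)
    (hφ : IsGelfandShilov M φ) (u : UltraE d M →ₗ[ℂ] ℂ) : Set (Sp d) :=
  {ξ | ξ ≠ 0 ∧ ∃ Γ : Set (Sp d), IsOpenCone Γ ∧ ξ ∈ Γ ∧ coneSeminorm p q ω φ hφ Γ u < ∞}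

/-- `Σ_ℬ(u)`: the complement of `Θ_ℬ(u)` in `ℝ^d \ 0`. -/
def singularDirections (p q : ℝ≥0∞) (ω : Sp d × Sp d → ℝ) (φ : Sp d → ℂ)
    (hφ : IsGelfandShilov M φ) (u : UltraE d M →ₗ[ℂ] ℂ) : Set (Sp d) :=
  {ξ | ξ ≠ 0 ∧ ξ ∉ regularDirections p q ω φ hφ u}

/-- The wave-front set `WF_ℬ(f)` with respect to `ℬ = M^{p,q}_{(ω)}`, computed with window `φ`:
the pairs `(x₀, ξ₀)`, `ξ₀ ≠ 0`, such that `ξ₀ ∈ Σ_ℬ(χ f)` for every `χ ∈ 𝒟^{(M_p)}(ℝ^d)` with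
`χ(x₀) ≠ 0`. -/
def waveFrontSet (p q : ℝ≥0∞) (ω : Sp d × Sp d → ℝ) (φ : Sp d → ℂ)
    (hφ : IsGelfandShilov M φ) (f : Ultradistribution d M) : Set (Sp d × Sp d) :=
  {z | z.2 ≠ 0 ∧ ∀ χ : UltraD d M, (χ : Sp d → ℂ) z.1 ≠ 0 →
    z.2 ∈ singularDirections p q ω φ hφ (localize f χ)}

end UltraWF

end

/-!
The independence of the wave-front set of the exponent `p` and of the window `φ` comes from one
observation: if a direction is regular for `χ f`, measured with `(p₁, φ₁)`, then it is regular for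
`χ² f`, measured with any other pair `(p₂, φ₂)` (`mem_regularDirections_testMul_self`). As `χ² x₀`
vanishes exactly when `χ x₀` does, every point outside one wave-front set is outside the other.

*Change of window.* Up to the factor `‖φ₁‖²`, the function `χ conj φ₂(· - x)` is the integral over
`x'` of `conj φ₁(· - x')` times the compactly supported ultradifferentiable function
`χ φ₁(· - x') conj φ₂(· - x)`. The latter is expanded in a Fourier series with frequencies in a
lattice `τ ℤ^d`, where `τ` is so small that the support of `χ` embeds in the dual torus. Pairing
with `χ f` expresses the short-time Fourier transform of `χ² f` with window `φ₂` at `(x, ξ)` as an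
integral over `x'` and a sum over `k` of the transforms of `χ f` with window `φ₁` at
`(x', ξ + τ k)`, with the Fourier coefficients as weights (`integral_mul_localize_stftAtom`). Only
scalar integrals and sums occur, since the functional is continuous along Fourier series
(`hasSum_localize_test`).

*Decay.* By `(M.2)` products of dilates of `e^{M(ρ)}` are again bounded by a dilate, and the inverse
of `e^{M(hρ)}` is integrable, or summable over a lattice, for each `h > 0`. The Fourier coefficients
above decay like `1 / e^{M(h ·)}` in `x`, `x'` and `τ k`, with `h` as large as desired
(`exists_norm_latticeCoeff_windowProd_le`), which absorbs the growth of the moderate weight `ω`.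
What remains (`exists_enorm_stft_mul_le`) is a rapidly decaying function of `x` times a discrete
convolution in `ξ` of `frequencyMass`, a rapidly weighted `L¹` norm in `x'`. The function of `x` is
in every `L^{p₂}`, and Hölder's inequality bounds `frequencyMass` by the `L^{p₁}` norm
(`exists_frequencyMass_le_eLpNorm`); this is why `p` plays no role.

*Cones.* For `ξ` in a smaller cone, either `ξ + τ k` is in the original cone, and the discrete
Minkowski inequality applies, or `|τ k|` is at least a multiple of `|ξ|`, and the decay in `k` beats
the a priori growth of the transform (`exists_cone_eLpNorm_tsum_lt_top`).
-/

noncomputable section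

namespace UltraWF

/-! ### The exponential of the associated function -/

namespace WeightSequence

variable (M : WeightSequence)

/-- The exponential `e^{M(ρ)}` of the associated function; for `ρ ≥ 0` it is `sup_n ρ^n / M_n`. -/
def wt (ρ : ℝ) : ℝ := Real.exp (M.assoc ρ)

lemma wt_pos (ρ : ℝ) : 0 < M.wt ρ := Real.exp_pos _

lemma bddAbove_assoc_of_nonneg {ρ : ℝ} (hρ : 0 ≤ ρ) :
    BddAbove (Set.range fun p : ℕ => Real.posLog (ρ ^ p * M.seq 0 / M.seq p)) := by
  obtain ⟨C, hC⟩ := M.bddAbove_assoc (ρ + 1) (by linarith)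
  refine ⟨C, ?_⟩
  rintro _ ⟨p, rfl⟩
  have h1 := M.pos p
  refine le_trans (Real.posLog_le_posLog (by rw [M.zero]; positivity) ?_) (hC ⟨p, rfl⟩)
  rw [M.zero]
  gcongr
  linarith

lemma pow_le_seq_mul_wt {ρ : ℝ} (hρ : 0 ≤ ρ) (n : ℕ) : ρ ^ n ≤ M.seq n * M.wt ρ := by
  have h1 := M.pos n
  have h2 := le_ciSup (M.bddAbove_assoc_of_nonneg hρ) n
  simp only [M.zero, mul_one] at h2
  rw [← div_le_iff₀' h1]
  rcases (div_nonneg (pow_nonneg hρ n) h1.le).eq_or_lt with h | h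
  · rw [← h]; exact (M.wt_pos ρ).le
  · rw [← Real.exp_log h]
    have h3 : Real.log (ρ ^ n / M.seq n) ≤ Real.posLog (ρ ^ n / M.seq n) := le_max_right 0 _
    refine Real.exp_le_exp.2 (h3.trans ?_)
    simpa only [assoc, M.zero, mul_one] using h2

lemma one_le_wt {ρ : ℝ} (hρ : 0 ≤ ρ) : 1 ≤ M.wt ρ := by
  simpa [M.zero] using M.pow_le_seq_mul_wt hρ 0

/-- The least-upper-bound property of `wt`, in a form free of division by `X`. -/
lemma mul_wt_le {X c ρ : ℝ} (hρ : 0 ≤ ρ) (hX : 0 ≤ X) (h : ∀ n, X * ρ ^ n ≤ c * M.seq n) :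
    X * M.wt ρ ≤ c := by
  have h0 : X ≤ c := by simpa [M.zero] using h 0
  rcases hX.eq_or_lt with rfl | hX
  · simpa using h0
  rw [← le_div_iff₀' hX]
  have hc : 0 < c / X := div_pos (hX.trans_le h0) hX
  rw [wt, ← Real.le_log_iff_exp_le hc]
  refine ciSup_le fun n => ?_
  have h1 := M.pos n
  have h2 : 1 ≤ |c / X| := by rw [abs_of_pos hc, le_div_iff₀ hX]; linarith
  rw [← Real.posLog_eq_log h2]
  refine Real.posLog_le_posLog (by rw [M.zero]; positivity) ?_
  rw [M.zero, mul_one, div_le_div_iff₀ h1 hX]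
  linarith [h n]

lemma wt_mono {a b : ℝ} (ha : 0 ≤ a) (hab : a ≤ b) : M.wt a ≤ M.wt b := by
  have := M.mul_wt_le (X := 1) (c := M.wt b) ha zero_le_one fun n => by
    rw [one_mul, mul_comm]
    exact (pow_le_pow_left₀ ha hab n).trans (M.pow_le_seq_mul_wt (ha.trans hab) n)
  simpa using this

/-- Condition `(M.2)` bounds the square of `wt` by a dilate of `wt`. -/
lemma exists_wt_sq_le : ∃ A H : ℝ, 0 < A ∧ 1 ≤ H ∧ ∀ ρ, 0 ≤ ρ →
    M.wt ρ * M.wt ρ ≤ A * M.wt (H * ρ) := by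
  obtain ⟨A, H, hA, hH, h⟩ := M.stable
  refine ⟨A, max H 1, hA, le_max_right _ _, fun ρ hρ => ?_⟩
  refine M.mul_wt_le hρ (M.wt_pos _).le fun p => ?_
  have hp := M.pos p
  rw [mul_comm, mul_assoc]
  have : ρ ^ p * M.wt ρ ≤ A * M.wt (H * ρ) * M.seq p := by
    refine M.mul_wt_le hρ (by positivity) fun q => ?_
    have hq := M.pos q
    have h1 := M.pow_le_seq_mul_wt (mul_nonneg hH.le hρ) (p + q)
    have h2 := h p q
    have hw := M.wt_pos (H * ρ)
    have h3 : (0:ℝ) < H ^ (p + q) := by positivity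
    rw [mul_pow] at h1
    refine le_of_mul_le_mul_left ?_ h3
    calc H ^ (p + q) * (ρ ^ p * ρ ^ q) = H ^ (p + q) * ρ ^ (p + q) := by rw [pow_add ρ]
      _ ≤ M.seq (p + q) * M.wt (H * ρ) := h1
      _ ≤ (A * H ^ (p + q) * M.seq p * M.seq q) * M.wt (H * ρ) := by gcongr
      _ = _ := by ring
  calc ρ ^ p * M.wt ρ ≤ A * M.wt (H * ρ) * M.seq p := this
    _ ≤ A * M.wt (max H 1 * ρ) * M.seq p := by
      gcongr
      exact M.wt_mono (by positivity) (by gcongr; exact le_max_left _ _)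
    _ = _ := by ring

lemma wt_add_le {a b : ℝ} (ha : 0 ≤ a) (hb : 0 ≤ b) :
    M.wt (a + b) ≤ M.wt (2 * a) * M.wt (2 * b) := by
  have h1 := M.one_le_wt (ρ := 2 * a) (by positivity)
  have h2 := M.one_le_wt (ρ := 2 * b) (by positivity)
  rcases le_total a b with h | h
  · calc M.wt (a + b) ≤ M.wt (2 * b) := M.wt_mono (by positivity) (by linarith)
      _ ≤ _ := le_mul_of_one_le_left (by positivity) h1
  · calc M.wt (a + b) ≤ M.wt (2 * a) := M.wt_mono (by positivity) (by linarith)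
      _ ≤ _ := le_mul_of_one_le_right (by positivity) h2

/-- Finite products of dilates of `wt` are dominated by a single dilate. -/
lemma exists_wt_mul_wt_le {a b : ℝ} (ha : 0 ≤ a) (hb : 0 ≤ b) : ∃ C h : ℝ, 0 < C ∧ 0 < h ∧
    ∀ ρ, 0 ≤ ρ → M.wt (a * ρ) * M.wt (b * ρ) ≤ C * M.wt (h * ρ) := by
  obtain ⟨A, H, hA, hH, h⟩ := M.exists_wt_sq_le
  refine ⟨A, H * (max (max a b) 1), hA, by positivity, fun ρ hρ => ?_⟩
  have hm : 0 ≤ max (max a b) 1 := by positivity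
  rw [mul_assoc]
  refine le_trans ?_ (h _ (by positivity))
  have h1 := M.wt_pos (b * ρ)
  have h2 := M.wt_pos (max (max a b) 1 * ρ)
  gcongr
  · exact M.wt_mono (by positivity) (by gcongr; exact le_max_of_le_left (le_max_left _ _))
  · exact M.wt_mono (by positivity) (by gcongr; exact le_max_of_le_left (le_max_right _ _))

/-- `1 / wt` decays faster than every power. -/
lemma exists_inv_wt_le (n : ℕ) {h : ℝ} (hh : 0 < h) : ∃ C : ℝ, 0 < C ∧ ∀ ρ, 0 ≤ ρ →
    (M.wt (h * ρ))⁻¹ ≤ C * ((1 + ρ) ^ n)⁻¹ := by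
  have hn := M.pos n
  refine ⟨2 ^ n * (1 + M.seq n / h ^ n), by positivity, fun ρ hρ => ?_⟩
  have h1 := M.one_le_wt (ρ := h * ρ) (by positivity)
  have h2 := M.pow_le_seq_mul_wt (ρ := h * ρ) (by positivity) n
  have hw := M.wt_pos (h * ρ)
  rw [← div_eq_mul_inv, inv_le_comm₀ hw (by positivity), inv_div, div_le_iff₀' (by positivity)]
  have h3 : (1 + ρ) ^ n ≤ 2 ^ n * (1 + ρ ^ n) := by
    have : (1 + ρ) ^ n ≤ (2 * max 1 ρ) ^ n := by
      gcongr
      linarith [le_max_left 1 ρ, le_max_right 1 ρ]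
    refine this.trans ?_
    rw [mul_pow]
    gcongr
    rcases le_total 1 ρ with h | h
    · rw [max_eq_right h]; linarith
    · rw [max_eq_left h, one_pow]; linarith [pow_nonneg hρ n]
  have h4 : ρ ^ n ≤ M.seq n / h ^ n * M.wt (h * ρ) := by
    rw [div_mul_eq_mul_div, le_div_iff₀ (by positivity), mul_comm, ← mul_pow]
    exact h2
  calc (1 + ρ) ^ n ≤ 2 ^ n * (1 + ρ ^ n) := h3
    _ ≤ 2 ^ n * (1 * M.wt (h * ρ) + M.seq n / h ^ n * M.wt (h * ρ)) := by
      gcongr; linarith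
    _ = _ := by ring

lemma measurable_wt_norm {E : Type*} [NormedAddCommGroup E] [MeasurableSpace E] [BorelSpace E]
    (h : ℝ) (hh : 0 ≤ h) : Measurable fun x : E => M.wt (h * ‖x‖) := by
  -- `wt` is monotone on `[0, ∞)`, so precompose with the positive part to get a monotone function
  have h1 : Monotone fun ρ : ℝ => M.wt (max ρ 0) := fun a b hab =>
    M.wt_mono (le_max_right _ _) (max_le_max_right _ hab)
  have h2 : (fun x : E => M.wt (h * ‖x‖)) = (fun ρ : ℝ => M.wt (max ρ 0)) ∘ fun x => h * ‖x‖ := by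
    funext x
    simp [max_eq_left (mul_nonneg hh (norm_nonneg x))]
  rw [h2]
  exact h1.measurable.comp (by fun_prop)

lemma integrable_inv_wt {d : ℕ} {h : ℝ} (hh : 0 < h) :
    MeasureTheory.Integrable fun x : Sp d => (M.wt (h * ‖x‖))⁻¹ := by
  obtain ⟨C, hC, H⟩ := M.exists_inv_wt_le (d + 1) hh
  have h1 : MeasureTheory.Integrable fun x : Sp d => (1 + ‖x‖) ^ (-((d + 1 : ℕ) : ℝ)) :=
    integrable_one_add_norm (by simp)
  refine (h1.const_mul C).mono' (M.measurable_wt_norm h hh.le).inv.aestronglyMeasurable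
    (Filter.Eventually.of_forall fun x => ?_)
  rw [Real.norm_of_nonneg (inv_nonneg.2 (M.wt_pos _).le), Real.rpow_neg (by positivity),
    Real.rpow_natCast]
  exact H _ (norm_nonneg _)

end WeightSequence

lemma eLpNorm_lt_top_of_integrable_of_le_one {α : Type*} [MeasurableSpace α]
    {μ : MeasureTheory.Measure α} {f : α → ℝ} (hf : MeasureTheory.Integrable f μ)
    (h1 : ∀ x, ‖f x‖ ≤ 1) {q : ℝ≥0∞} (hq : 1 ≤ q) : MeasureTheory.eLpNorm f q μ < ∞ := by
  rcases eq_or_ne q ∞ with rfl | hq'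
  · exact (MeasureTheory.memLp_top_of_bound hf.1 1 (Filter.Eventually.of_forall h1)).2
  rw [MeasureTheory.eLpNorm_lt_top_iff_lintegral_rpow_enorm_lt_top (by positivity) hq']
  refine lt_of_le_of_lt (MeasureTheory.lintegral_mono fun x => ?_) hf.2
  have h2 : ‖f x‖ₑ ≤ 1 := by
    rw [← enorm_one (G := ℝ), enorm_le_iff_norm_le]; simpa using h1 x
  have h3 : 1 ≤ q.toReal := by
    rw [← ENNReal.toReal_one]; exact ENNReal.toReal_mono hq' hq
  calc ‖f x‖ₑ ^ q.toReal ≤ ‖f x‖ₑ ^ (1 : ℝ) := ENNReal.rpow_le_rpow_of_exponent_ge h2 h3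
    _ = _ := ENNReal.rpow_one _

/-- The point `τ k` of the lattice `τ ℤ^d`. -/
def latticePoint {d : ℕ} (τ : ℝ) (k : Fin d → ℤ) : Sp d := WithLp.toLp 2 fun i => τ * (k i : ℝ)

lemma latticePoint_neg {d : ℕ} (τ : ℝ) (k : Fin d → ℤ) :
    latticePoint τ (-k) = -latticePoint τ k := by
  ext i; simp [latticePoint]

lemma norm_latticePoint {d : ℕ} {τ : ℝ} (hτ : 0 ≤ τ) (k : Fin d → ℤ) :
    ‖latticePoint τ k‖ = τ * ‖latticePoint 1 k‖ := by
  have : latticePoint τ k = τ • latticePoint 1 k := by ext i; simp [latticePoint]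
  rw [this, norm_smul, Real.norm_of_nonneg hτ]

lemma summable_inv_one_add_norm_latticePoint (d : ℕ) :
    Summable fun k : Fin d → ℤ => ((1 + ‖latticePoint 1 k‖) ^ (d + 1))⁻¹ := by
  set b := (EuclideanSpace.basisFun (Fin d) ℝ).toBasis
  set L : Submodule ℤ (Sp d) := Submodule.span ℤ (Set.range b)
  have hmem : ∀ k : Fin d → ℤ, latticePoint 1 k ∈ L := fun k => by
    have : latticePoint 1 k = ∑ i, k i • b i := by
      ext j
      simp [latticePoint, b, Finset.sum_apply, Pi.single_apply]
    rw [this]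
    exact Submodule.sum_mem _ fun i _ =>
      Submodule.smul_mem _ _ (Submodule.subset_span (Set.mem_range_self i))
  have hinj : Function.Injective fun k : Fin d → ℤ => (⟨latticePoint 1 k, hmem k⟩ : L) := by
    intro k l h
    funext i
    have h1 := congrArg (fun v : Sp d => v i) (Subtype.ext_iff.1 h)
    simpa [latticePoint] using h1
  have hs : Summable fun z : L => ‖z‖⁻¹ ^ (d + 1) := by
    refine ZLattice.summable_norm_pow_inv L (d + 1) ?_
    rw [ZLattice.rank ℝ L]
    simp
  have hs' := hs.comp_injective hinj
  refine Summable.of_norm_bounded_eventually hs' ?_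
  have hfin : {k : Fin d → ℤ | ¬ k ≠ 0}.Finite := by simp
  filter_upwards [hfin.compl_mem_cofinite] with k hk
  have hk : k ≠ 0 := by simpa using hk
  have hpos : 0 < ‖latticePoint 1 k‖ := by
    rw [norm_pos_iff]
    intro h
    apply hk
    funext i
    simpa [latticePoint] using congrArg (fun v : Sp d => v i) h
  rw [Real.norm_of_nonneg (by positivity), ← inv_pow]
  simp only [Function.comp_apply, Submodule.coe_norm]
  gcongr
  linarith

lemma WeightSequence.summable_inv_wt_latticePoint (M : WeightSequence) (d : ℕ) {h τ : ℝ}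
    (hh : 0 < h) (hτ : 0 < τ) :
    Summable fun k : Fin d → ℤ => (M.wt (h * ‖latticePoint τ k‖))⁻¹ := by
  obtain ⟨C, hC, H⟩ := M.exists_inv_wt_le (d + 1) (mul_pos hh hτ)
  refine Summable.of_nonneg_of_le (fun k => inv_nonneg.2 (M.wt_pos _).le) (fun k => ?_)
    ((summable_inv_one_add_norm_latticePoint d).mul_left C)
  rw [norm_latticePoint hτ.le, ← mul_assoc]
  exact H _ (norm_nonneg _)

/-! ### Quantitative ultradifferentiability -/

variable {d : ℕ} {M : WeightSequence}

/-- The bounds `‖g^{(n)}‖ ≤ c B^n M_n` on the set `K`. -/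
def UltraBound (M : WeightSequence) (K : Set (Sp d)) (c B : ℝ) (g : Sp d → ℂ) : Prop :=
  ∀ n, ∀ y ∈ K, ‖iteratedFDeriv ℝ n g y‖ ≤ c * (B ^ n * M.seq n)

/-- In a product the constants multiply while the radii add. -/
lemma UltraBound.mul {K : Set (Sp d)} {c₁ c₂ B₁ B₂ : ℝ} {f g : Sp d → ℂ}
    (hc₁ : 0 ≤ c₁) (hc₂ : 0 ≤ c₂) (hB₁ : 0 ≤ B₁) (hB₂ : 0 ≤ B₂)
    (hf : ContDiff ℝ (⊤ : ℕ∞) f) (hg : ContDiff ℝ (⊤ : ℕ∞) g)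
    (h₁ : UltraBound M K c₁ B₁ f) (h₂ : UltraBound M K c₂ B₂ g) :
    UltraBound M K (c₁ * c₂) (B₁ + B₂) (f * g) := by
  intro n y hy
  have h := norm_iteratedFDeriv_mul_le (𝕜 := ℝ) hf hg y (n := n) (mod_cast le_top)
  refine h.trans ?_
  rw [add_pow, Finset.sum_mul, Finset.mul_sum]
  refine Finset.sum_le_sum fun i hi => ?_
  have hin : i + (n - i) = n := by
    have := Finset.mem_range.1 hi
    omega
  have hM := M.seq_mul_le i (n - i)
  rw [hin] at hM
  have p1 := M.pos i
  have p2 := M.pos (n - i)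
  calc (n.choose i : ℝ) * ‖iteratedFDeriv ℝ i f y‖ * ‖iteratedFDeriv ℝ (n - i) g y‖
      ≤ (n.choose i : ℝ) * (c₁ * (B₁ ^ i * M.seq i)) * (c₂ * (B₂ ^ (n - i) * M.seq (n - i))) := by
        gcongr
        · exact h₁ i y hy
        · exact h₂ (n - i) y hy
    _ = c₁ * c₂ * (B₁ ^ i * B₂ ^ (n - i) * n.choose i * (M.seq i * M.seq (n - i))) := by ring
    _ ≤ _ := by gcongr

lemma UltraBound.conj {K : Set (Sp d)} {c B : ℝ} {g : Sp d → ℂ} (h : UltraBound M K c B g) :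
    UltraBound M K c B (fun y => conj (g y)) := by
  intro n y hy
  have e := LinearIsometryEquiv.norm_iteratedFDeriv_comp_left (𝕜 := ℝ) Complex.conjLIE g y n
  have e' : (fun y => conj (g y)) = Complex.conjLIE ∘ g := rfl
  rw [e', e]
  exact h n y hy

lemma contDiff_conj {g : Sp d → ℂ} (hg : ContDiff ℝ (⊤ : ℕ∞) g) :
    ContDiff ℝ (⊤ : ℕ∞) (fun y => conj (g y)) :=
  Complex.conjCLE.contDiff.comp hg

lemma IsUltraDiff.exists_ultraBound {g : Sp d → ℂ} (hg : IsUltraDiff M g) {K : Set (Sp d)}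
    (hK : IsCompact K) {B : ℝ} (hB : 0 < B) : ∃ c, 0 ≤ c ∧ UltraBound M K c B g := by
  obtain ⟨C, hC, H⟩ := ((isUltraDiff_iff M).1 hg).2 K hK B⁻¹ (inv_pos.2 hB)
  refine ⟨C, hC, fun n y hy => ?_⟩
  have h := H n y hy
  rw [inv_pow, inv_mul_le_iff₀ (by positivity)] at h
  linarith

/-- The bounds defining the Gelfand–Shilov space, with the decay in `x` written through `wt`. -/
lemma IsGelfandShilov.exists_wt_mul_le {φ : Sp d → ℂ} (hφ : IsGelfandShilov M φ) {h B : ℝ}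
    (hh : 0 < h) (hB : 0 < B) : ∃ C, 0 ≤ C ∧ ∀ n x,
      M.wt (h * ‖x‖) * ‖iteratedFDeriv ℝ n φ x‖ ≤ C * (B ^ n * M.seq n) := by
  obtain ⟨C, hC⟩ := hφ.2 h⁻¹ B (inv_pos.2 hh) hB
  refine ⟨max C 0, le_max_right _ _, fun n x => ?_⟩
  have hn := M.pos n
  rw [mul_comm]
  refine M.mul_wt_le (by positivity) (norm_nonneg _) fun m => ?_
  have hm := M.pos m
  have h1 := hC m n x
  rw [mul_pow]
  calc ‖iteratedFDeriv ℝ n φ x‖ * (h ^ m * ‖x‖ ^ m)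
      = h ^ m * (‖x‖ ^ m * ‖iteratedFDeriv ℝ n φ x‖) := by ring
    _ ≤ h ^ m * (C * (h⁻¹ ^ m * M.seq m) * (B ^ n * M.seq n)) := by gcongr
    _ = C * (B ^ n * M.seq n) * M.seq m := by
      rw [inv_pow]; field_simp
    _ ≤ _ := by gcongr; exact le_max_left _ _

/-- On a fixed bounded set, the translates `φ(· - x)` of a Gelfand–Shilov function obey
ultradifferentiable bounds whose constant decays rapidly in `x`. -/
lemma IsGelfandShilov.exists_ultraBound_translate {φ : Sp d → ℂ} (hφ : IsGelfandShilov M φ)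
    {K : Set (Sp d)} (hK : Bornology.IsBounded K) {h B : ℝ} (hh : 0 < h) (hB : 0 < B) :
    ∃ C, 0 ≤ C ∧ ∀ x, UltraBound M K (C * (M.wt (h * ‖x‖))⁻¹) B (fun y => φ (y - x)) := by
  obtain ⟨R, hR⟩ := hK.exists_norm_le
  obtain ⟨C, hC, H⟩ := hφ.exists_wt_mul_le (h := 2 * h) (by positivity) hB
  have hw : 0 < M.wt (2 * (h * max R 0)) := M.wt_pos _
  refine ⟨M.wt (2 * (h * max R 0)) * C, by positivity, fun x n y hy => ?_⟩
  have hwx := M.wt_pos (h * ‖x‖)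
  have hn := M.pos n
  rw [iteratedFDeriv_comp_sub]
  have h1 : M.wt (h * ‖x‖) ≤ M.wt (2 * (h * max R 0)) * M.wt (2 * h * ‖y - x‖) := by
    rw [mul_assoc 2 h ‖y - x‖]
    refine le_trans (M.wt_mono (by positivity) ?_) (M.wt_add_le (by positivity) (by positivity))
    rw [← mul_add]
    have h2 : ‖x‖ ≤ ‖y‖ + ‖y - x‖ := by
      calc ‖x‖ = ‖y - (y - x)‖ := by congr 1; abel
        _ ≤ _ := norm_sub_le _ _
    have h3 := (hR y hy).trans (le_max_left R 0)
    gcongr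
    linarith
  have h2 := H n (y - x)
  rw [mul_right_comm, ← div_eq_mul_inv, le_div_iff₀ hwx]
  calc ‖iteratedFDeriv ℝ n φ (y - x)‖ * M.wt (h * ‖x‖)
      ≤ ‖iteratedFDeriv ℝ n φ (y - x)‖ * (M.wt (2 * (h * max R 0)) * M.wt (2 * h * ‖y - x‖)) := by
        gcongr
    _ = M.wt (2 * (h * max R 0)) * (M.wt (2 * h * ‖y - x‖) * ‖iteratedFDeriv ℝ n φ (y - x)‖) := by
        ring
    _ ≤ M.wt (2 * (h * max R 0)) * (C * (B ^ n * M.seq n)) := by gcongr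
    _ = _ := by ring

/-- The translates of a Gelfand–Shilov function depend Lipschitz-continuously on the translation, in
the ultradifferentiable norms. -/
lemma IsGelfandShilov.exists_ultraBound_sub {φ : Sp d → ℂ} (hφ : IsGelfandShilov M φ)
    {B : ℝ} (hB : 0 < B) :
    ∃ C, 0 ≤ C ∧ ∀ x x', UltraBound M Set.univ (C * ‖x - x'‖) B
      (fun y => φ (y - x) - φ (y - x')) := by
  obtain ⟨A, H, hA, hH, hM⟩ := M.stable
  obtain ⟨C, hC, hφ'⟩ := hφ.exists_wt_mul_le (h := 1) one_pos (B := B / H) (by positivity)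
  have h1pos := M.pos 1
  have hder : ∀ n x, ‖iteratedFDeriv ℝ (n + 1) φ x‖ ≤
      C * (A * B * M.seq 1) * (B ^ n * M.seq n) := by
    intro n x
    have hn := M.pos n
    have h1 := M.one_le_wt (ρ := 1 * ‖x‖) (by positivity)
    calc ‖iteratedFDeriv ℝ (n + 1) φ x‖ ≤ M.wt (1 * ‖x‖) * ‖iteratedFDeriv ℝ (n + 1) φ x‖ :=
          le_mul_of_one_le_left (norm_nonneg _) h1
      _ ≤ C * ((B / H) ^ (n + 1) * M.seq (n + 1)) := hφ' _ _
      _ ≤ C * ((B / H) ^ (n + 1) * (A * H ^ (n + 1) * M.seq n * M.seq 1)) := by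
          gcongr; exact hM n 1
      _ = _ := by
          rw [div_pow]; field_simp; ring
  refine ⟨C * (A * B * M.seq 1), by positivity, fun x x' n y _ => ?_⟩
  have hn : ∀ a : Sp d, ContDiff ℝ (⊤ : ℕ∞) (fun y => φ (y - a)) := fun a =>
    hφ.1.comp (contDiff_id.sub contDiff_const)
  have e : (fun y => φ (y - x) - φ (y - x')) = (fun y => φ (y - x)) - (fun y => φ (y - x')) := rfl
  rw [e, iteratedFDeriv_sub_apply ((hn x).of_le (mod_cast le_top)).contDiffAt
    ((hn x').of_le (mod_cast le_top)).contDiffAt, iteratedFDeriv_comp_sub,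
    iteratedFDeriv_comp_sub]
  have hmv := Convex.norm_image_sub_le_of_norm_fderiv_le (𝕜 := ℝ)
    (f := iteratedFDeriv ℝ n φ) (s := Set.univ) (x := y - x') (y := y - x)
    (C := C * (A * B * M.seq 1) * (B ^ n * M.seq n))
    (fun z _ => (hφ.1.differentiable_iteratedFDeriv (mod_cast WithTop.coe_lt_top _)) z)
    (fun z _ => by rw [norm_fderiv_iteratedFDeriv]; exact hder n z)
    convex_univ (Set.mem_univ _) (Set.mem_univ _)
  refine hmv.trans (le_of_eq ?_)
  rw [show y - x - (y - x') = -(x - x') by abel, norm_neg]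
  ring

/-- The character `y ↦ e^{-i⟨ξ,y⟩}`. -/
def character (ξ y : Sp d) : ℂ := Complex.exp (-Complex.I * (inner ℝ ξ y : ℝ))

lemma character_add (ξ η y : Sp d) : character (ξ + η) y = character ξ y * character η y := by
  rw [character, character, character, ← Complex.exp_add, inner_add_left]
  push_cast; ring_nf

/-- The function `t ↦ e^{-it}`, through which every character factors. -/
def unitExp (t : ℝ) : ℂ := Complex.exp (-Complex.I * (t : ℂ))

lemma contDiff_unitExp : ContDiff ℝ (⊤ : ℕ∞) unitExp :=
  (contDiff_const.mul Complex.ofRealCLM.contDiff).cexp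

lemma hasDerivAt_unitExp (t : ℝ) : HasDerivAt unitExp (-Complex.I * unitExp t) t := by
  have h1 : HasDerivAt (fun t : ℝ => -Complex.I * (t : ℂ)) (-Complex.I) t := by
    simpa using (Complex.ofRealCLM.hasDerivAt (x := t)).const_mul (-Complex.I)
  rw [mul_comm]
  exact h1.cexp

lemma iteratedDeriv_unitExp (n : ℕ) :
    iteratedDeriv n unitExp = fun t : ℝ => (-Complex.I) ^ n * unitExp t := by
  induction n with
  | zero => simp
  | succ n ih =>
    rw [iteratedDeriv_succ, ih]
    funext t
    rw [((hasDerivAt_unitExp t).const_mul _).deriv]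
    ring

lemma norm_unitExp (t : ℝ) : ‖unitExp t‖ = 1 := by
  simp [unitExp, Complex.norm_exp]

lemma character_eq (ξ : Sp d) : character ξ = unitExp ∘ (innerSL ℝ ξ : Sp d →L[ℝ] ℝ) := by
  funext y; simp [unitExp, character]

lemma contDiff_character (ξ : Sp d) : ContDiff ℝ (⊤ : ℕ∞) (character ξ) := by
  rw [character_eq]
  exact contDiff_unitExp.comp (innerSL ℝ ξ).contDiff

lemma norm_iteratedFDeriv_character_le (ξ : Sp d) (n : ℕ) (y : Sp d) :
    ‖iteratedFDeriv ℝ n (character ξ) y‖ ≤ ‖ξ‖ ^ n := by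
  rw [character_eq, ContinuousLinearMap.iteratedFDeriv_comp_right _ contDiff_unitExp y
    (mod_cast le_top)]
  refine (ContinuousMultilinearMap.norm_compContinuousLinearMap_le _ _).trans ?_
  rw [Finset.prod_const, Finset.card_univ, Fintype.card_fin, innerSL_apply_norm,
    norm_iteratedFDeriv_eq_norm_iteratedDeriv, iteratedDeriv_unitExp]
  simp [norm_unitExp]

lemma ultraBound_character {B : ℝ} (hB : 0 < B) (ξ : Sp d) :
    UltraBound M Set.univ (M.wt (B⁻¹ * ‖ξ‖)) B (character ξ) := by
  intro n y _
  refine (norm_iteratedFDeriv_character_le ξ n y).trans ?_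
  have h := M.pow_le_seq_mul_wt (ρ := B⁻¹ * ‖ξ‖) (by positivity) n
  rw [mul_pow, inv_pow, inv_mul_le_iff₀ (by positivity)] at h
  linarith

lemma UltraBound.subset {K K' : Set (Sp d)} {c B : ℝ} {g : Sp d → ℂ}
    (h : UltraBound M K c B g) (hK : K' ⊆ K) : UltraBound M K' c B g :=
  fun n y hy => h n y (hK hy)

/-- Small frequencies: on a bounded set `e^{-i⟨δ,·⟩} - 1` is `O(‖δ‖)` in the ultradifferentiable
norms. -/
lemma exists_ultraBound_character_sub_one {K : Set (Sp d)} (hK : Bornology.IsBounded K) {B : ℝ}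
    (hB : 0 < B) : ∃ C, 0 ≤ C ∧ ∀ δ : Sp d, ‖δ‖ ≤ 1 →
      UltraBound M K (C * ‖δ‖) B (fun y => character δ y - 1) := by
  obtain ⟨R, hR⟩ := hK.exists_norm_le
  have hw := M.wt_pos (B⁻¹ * 1)
  refine ⟨max R (M.wt (B⁻¹ * 1)), hw.le.trans (le_max_right _ _), fun δ hδ n y hy => ?_⟩
  have hn := M.pos n
  rcases Nat.eq_zero_or_pos n with rfl | hn0
  · rw [norm_iteratedFDeriv_zero, M.zero]
    have h1 : ‖character δ y - 1‖ ≤ |inner ℝ δ y| := by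
      have h2 := Convex.norm_image_sub_le_of_norm_hasDerivWithin_le (f := unitExp)
        (f' := fun t => -Complex.I * unitExp t) (s := Set.univ) (x := 0) (y := inner ℝ δ y)
        (C := 1) (fun t _ => (hasDerivAt_unitExp t).hasDerivWithinAt)
        (fun t _ => by simp [norm_unitExp]) convex_univ (Set.mem_univ _) (Set.mem_univ _)
      simpa [unitExp, character] using h2
    calc ‖character δ y - 1‖ ≤ |inner ℝ δ y| := h1
      _ ≤ ‖δ‖ * ‖y‖ := abs_real_inner_le_norm _ _
      _ ≤ ‖δ‖ * max R (M.wt (B⁻¹ * 1)) := by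
        gcongr; exact (hR y hy).trans (le_max_left _ _)
      _ = _ := by ring
  · have e : iteratedFDeriv ℝ n (fun y => character δ y - 1) y =
        iteratedFDeriv ℝ n (character δ) y := by
      have : (fun y => character δ y - 1) = character δ - fun _ => (1 : ℂ) := rfl
      rw [this, iteratedFDeriv_sub_apply
        ((contDiff_character δ).of_le (mod_cast le_top)).contDiffAt contDiffAt_const,
        iteratedFDeriv_const_of_ne hn0.ne']
      simp
    rw [e]
    have h := M.pow_le_seq_mul_wt (ρ := B⁻¹ * 1) (by positivity) n
    rw [mul_one, inv_pow, inv_le_iff_one_le_mul₀ (by positivity)] at h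
    have hd : ‖δ‖ ^ n ≤ ‖δ‖ := pow_le_of_le_one (norm_nonneg _) hδ hn0.ne'
    calc ‖iteratedFDeriv ℝ n (character δ) y‖ ≤ ‖δ‖ ^ n := norm_iteratedFDeriv_character_le _ _ _
      _ ≤ ‖δ‖ * 1 := by rw [mul_one]; exact hd
      _ ≤ ‖δ‖ * (M.seq n * M.wt (B⁻¹) * B ^ n) := by gcongr
      _ = (M.wt (B⁻¹ * 1) * ‖δ‖) * (B ^ n * M.seq n) := by rw [mul_one]; ring
      _ ≤ _ := by gcongr; exact le_max_right _ _

/-! ### Localized ultradistributions -/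

lemma UltraBound.ultraNorm_le {K : Set (Sp d)} {c A : ℝ} (hA : 0 < A) {g : Sp d → ℂ}
    (h : UltraBound M K c A⁻¹ g) : ultraNorm M A K g ≤ ENNReal.ofReal c := by
  refine iSup_le fun n => iSup₂_le fun y hy => ENNReal.ofReal_le_ofReal ?_
  have hn := M.pos n
  have h1 := h n y hy
  rw [inv_pow] at h1
  calc A ^ n / M.seq n * ‖iteratedFDeriv ℝ n g y‖
      ≤ A ^ n / M.seq n * (c * ((A ^ n)⁻¹ * M.seq n)) := by gcongr
    _ = c := by field_simp

/-- The product of a test function and an ultradifferentiable function. -/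
def testMul (χ : UltraD d M) (g : UltraE d M) : UltraD d M :=
  ⟨(χ : Sp d → ℂ) * (g : Sp d → ℂ), χ.2.1.mul g.2, χ.2.2.mul_right⟩

/-- The character `e^{-i⟨ξ,·⟩}` as an ultradifferentiable function. -/
def characterE (M : WeightSequence) (ξ : Sp d) : UltraE d M := ⟨character ξ, isUltraDiff_exp ξ⟩

/-- The complex conjugate of a translated window. -/
def windowE (φ : Sp d → ℂ) (hφ : IsGelfandShilov M φ) (x : Sp d) : UltraE d M :=
  ⟨fun y => conj (φ (y - x)), (hφ.isUltraDiff.comp_sub x).conj_comp⟩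

lemma localize_congr (f : Ultradistribution d M) (χ χ' : UltraD d M) (g g' : UltraE d M)
    (h : ∀ y, (χ : Sp d → ℂ) y * (g : Sp d → ℂ) y = (χ' : Sp d → ℂ) y * (g' : Sp d → ℂ) y) :
    localize f χ g = localize f χ' g' :=
  congrArg f.toLin (Subtype.ext (funext h))

/-- Continuity of a localized ultradistribution.  The argument `g` only matters on the support of
`χ`, so it may be replaced there by any smooth function `h` for which bounds are known. -/
lemma exists_norm_localize_le (f : Ultradistribution d M) (χ : UltraD d M) :
    ∃ B : ℝ, 0 < B ∧ ∃ C : ℝ, 0 ≤ C ∧ ∀ (g : UltraE d M) (h : Sp d → ℂ) (c : ℝ), 0 ≤ c →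
      ContDiff ℝ (⊤ : ℕ∞) h → UltraBound M (tsupport (χ : Sp d → ℂ)) c B h →
      (∀ y ∈ tsupport (χ : Sp d → ℂ), (g : Sp d → ℂ) y = h y) → ‖localize f χ g‖ ≤ C * c := by
  set K := tsupport (χ : Sp d → ℂ) with hKdef
  have hK : IsCompact K := χ.2.2
  obtain ⟨A, hA, C, hC⟩ := f.continuous' K hK
  obtain ⟨c₀, hc₀, hχ⟩ := χ.2.1.exists_ultraBound hK (B := A⁻¹ / 2) (by positivity)
  refine ⟨A⁻¹ / 2, by positivity, C * c₀, by positivity, fun g h c hc hh hb heq => ?_⟩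
  have e : (testMul χ g : Sp d → ℂ) = (χ : Sp d → ℂ) * h := by
    funext y
    by_cases hy : y ∈ K
    · simp [testMul, heq y hy]
    · have h0 : (χ : Sp d → ℂ) y = 0 := image_eq_zero_of_notMem_tsupport hy
      simp [testMul, h0]
  have hbd : UltraBound M K (c₀ * c) A⁻¹ (testMul χ g : Sp d → ℂ) := by
    rw [e]
    have := UltraBound.mul hc₀ hc (by positivity) (by positivity) χ.2.1.1 hh hχ hb
    rwa [add_halves] at this
  have h1 := hC (testMul χ g) (closure_mono (Function.support_mul_subset_left _ _))
  have h2 : ENNReal.ofReal ‖f.toLin (testMul χ g)‖ ≤ ENNReal.ofReal (C * (c₀ * c)) := by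
    refine h1.trans ?_
    rw [ENNReal.ofReal_mul (NNReal.coe_nonneg C), ENNReal.ofReal_coe_nnreal]
    exact mul_le_mul_right (hbd.ultraNorm_le hA) _
  rw [ENNReal.ofReal_le_ofReal_iff (by positivity)] at h2
  rw [mul_assoc]
  exact h2

/-- A trigonometric series that converges rapidly enough may be paired term by term with a
localized ultradistribution.  It is enough that the series represents `g` on the support of `χ`. -/
lemma hasSum_localize_character {ι : Type*} (f : Ultradistribution d M) (χ : UltraD d M)
    (g : UltraE d M) (c : ι → ℂ) (lam : ι → Sp d)
    (hc : ∀ h : ℝ, 0 < h → Summable fun k => ‖c k‖ * M.wt (h * ‖lam k‖))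
    (hg : ∀ y ∈ tsupport (χ : Sp d → ℂ),
      HasSum (fun k => c k * character (lam k) y) ((g : Sp d → ℂ) y)) :
    HasSum (fun k => c k * localize f χ (characterE M (lam k))) (localize f χ g) := by
  obtain ⟨B, hB, C, hC, hf⟩ := exists_norm_localize_le f χ
  set a : ι → ℝ := fun k => ‖c k‖ * M.wt (B⁻¹ * ‖lam k‖) with ha
  have hsum : Summable a := hc _ (inv_pos.2 hB)
  have hnn : ∀ k, 0 ≤ a k := fun k => mul_nonneg (norm_nonneg _) (M.wt_pos _).le
  have hbound : ∀ (n : ℕ) (k : ι) (y : Sp d),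
      ‖iteratedFDeriv ℝ n (fun y => c k * character (lam k) y) y‖ ≤
        a k * (B ^ n * M.seq n) := by
    intro n k y
    have e : (fun y => c k * character (lam k) y) = c k • character (lam k) := rfl
    rw [e, iteratedFDeriv_const_smul_apply
      ((contDiff_character _).of_le (mod_cast le_top)).contDiffAt, norm_smul, ha, mul_assoc]
    gcongr
    exact ultraBound_character hB (lam k) n y (Set.mem_univ y)
  have hsmooth : ∀ k, ContDiff ℝ (⊤ : ℕ∞) fun y => c k * character (lam k) y := fun k =>
    contDiff_const.mul (contDiff_character _)
  -- the remainder after the terms in `s` agrees on the support of `χ` with the tail of the series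
  have key : ∀ s : Finset ι, ‖∑ k ∈ s, c k * localize f χ (characterE M (lam k)) -
      localize f χ g‖ ≤ C * ∑' k : {k // k ∉ s}, a k := by
    intro s
    have hs : Summable fun k : {k // k ∉ s} => a k := hsum.subtype _
    have hv : ∀ n : ℕ, (n : ℕ∞) ≤ (⊤ : ℕ∞) →
        Summable fun k : {k // k ∉ s} => a k * (B ^ n * M.seq n) := fun n _ => hs.mul_right _
    have e1 : localize f χ g - ∑ k ∈ s, c k * localize f χ (characterE M (lam k)) =
        localize f χ (g - ∑ k ∈ s, c k • characterE M (lam k)) := by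
      simp only [map_sub, map_sum, map_smul, smul_eq_mul]
    rw [← norm_neg, neg_sub, e1]
    refine hf _ (fun y => ∑' k : {k // k ∉ s}, c k * character (lam k) y) _
      (tsum_nonneg fun k => hnn _)
      (contDiff_tsum (𝕜 := ℝ) (N := (⊤ : ℕ∞)) (fun k => hsmooth k) hv
        (fun n k y _ => hbound n k y)) ?_ ?_
    · intro n y hy
      rw [iteratedFDeriv_tsum_apply (𝕜 := ℝ) (N := (⊤ : ℕ∞))
        (f := fun (k : {k // k ∉ s}) y => c k * character (lam k) y) (fun k => hsmooth k) hv
        (fun n k y _ => hbound n k y) le_top, ← tsum_mul_right]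
      exact tsum_of_norm_bounded (hv n le_top).hasSum fun k => hbound n k y
    · intro y hy
      have h1 := hg y hy
      have h2 := h1.summable.sum_add_tsum_subtype_compl s
      rw [h1.tsum_eq] at h2
      have h3 : ((∑ k ∈ s, c k • characterE M (lam k) : UltraE d M) : Sp d → ℂ) y =
          ∑ k ∈ s, c k * character (lam k) y := by
        simp [characterE, Finset.sum_apply]
      rw [Submodule.coe_sub, Pi.sub_apply, h3, ← h2]
      simp
  rw [HasSum, SummationFilter.unconditional_filter, tendsto_iff_norm_sub_tendsto_zero]
  have htail := (tendsto_tsum_compl_atTop_zero a).const_mul C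
  rw [mul_zero] at htail
  exact squeeze_zero (fun _ => norm_nonneg _) key htail

/-! ### The short-time Fourier transform of a localized ultradistribution -/

lemma stftAtom_eq (φ : Sp d → ℂ) (hφ : IsGelfandShilov M φ) (x ξ y : Sp d) :
    (stftAtom φ hφ x ξ : Sp d → ℂ) y = conj (φ (y - x)) * character ξ y := rfl

lemma contDiff_window {φ : Sp d → ℂ} (hφ : IsGelfandShilov M φ) (x : Sp d) :
    ContDiff ℝ (⊤ : ℕ∞) (fun y => φ (y - x)) :=
  hφ.1.comp (contDiff_id.sub contDiff_const)

lemma exists_norm_localize_stftAtom_le (f : Ultradistribution d M) (χ : UltraD d M)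
    {φ : Sp d → ℂ} (hφ : IsGelfandShilov M φ) : ∃ C a : ℝ, 0 < C ∧ 0 < a ∧ ∀ x ξ,
      ‖localize f χ (stftAtom φ hφ x ξ)‖ ≤ C * M.wt (a * ‖ξ‖) := by
  obtain ⟨B, hB, C, hC, hf⟩ := exists_norm_localize_le f χ
  have hK : Bornology.IsBounded (tsupport (χ : Sp d → ℂ)) := χ.2.2.isBounded
  obtain ⟨C', hC', hb⟩ := hφ.exists_ultraBound_translate hK one_pos (half_pos hB)
  refine ⟨C * C' + 1, (B / 2)⁻¹, by positivity, by positivity, fun x ξ => ?_⟩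
  have hw := M.wt_pos ((B / 2)⁻¹ * ‖ξ‖)
  have hwx := M.wt_pos (1 * ‖x‖)
  have hw1 := M.one_le_wt (ρ := 1 * ‖x‖) (by positivity)
  have h1 := UltraBound.mul (by positivity) hw.le (by positivity) (by positivity)
    (contDiff_conj (contDiff_window hφ x)) (contDiff_character ξ) (hb x).conj
    ((ultraBound_character (half_pos hB) ξ).subset (Set.subset_univ _))
  rw [add_halves] at h1
  refine (hf _ _ _ (by positivity) ((contDiff_conj (contDiff_window hφ x)).mul
    (contDiff_character ξ)) h1 (fun y _ => rfl)).trans ?_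
  have h2 : (M.wt (1 * ‖x‖))⁻¹ ≤ 1 := inv_le_one_of_one_le₀ hw1
  calc C * (C' * (M.wt (1 * ‖x‖))⁻¹ * M.wt ((B / 2)⁻¹ * ‖ξ‖))
      ≤ C * (C' * 1 * M.wt ((B / 2)⁻¹ * ‖ξ‖)) := by gcongr
    _ ≤ _ := by nlinarith

lemma continuous_localize_stftAtom_left (f : Ultradistribution d M) (χ : UltraD d M)
    {φ : Sp d → ℂ} (hφ : IsGelfandShilov M φ) (ξ : Sp d) :
    Continuous fun x => localize f χ (stftAtom φ hφ x ξ) := by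
  obtain ⟨B, hB, C, hC, hf⟩ := exists_norm_localize_le f χ
  obtain ⟨C', hC', hb⟩ := hφ.exists_ultraBound_sub (half_pos hB)
  have hw := M.wt_pos ((B / 2)⁻¹ * ‖ξ‖)
  rw [continuous_iff_continuousAt]
  intro x₀
  rw [ContinuousAt, tendsto_iff_norm_sub_tendsto_zero]
  refine squeeze_zero (g := fun x => C * (C' * ‖x - x₀‖ * M.wt ((B / 2)⁻¹ * ‖ξ‖)))
    (fun _ => norm_nonneg _) (fun x => ?_) ?_
  · rw [← map_sub]
    have hs : ContDiff ℝ (⊤ : ℕ∞) fun y => φ (y - x) - φ (y - x₀) :=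
      (contDiff_window hφ x).sub (contDiff_window hφ x₀)
    have h1 := UltraBound.mul (K := tsupport (χ : Sp d → ℂ)) (by positivity) hw.le
      (by positivity) (by positivity) (contDiff_conj hs) (contDiff_character ξ)
      ((hb x x₀).subset (Set.subset_univ _)).conj
      ((ultraBound_character (half_pos hB) ξ).subset (Set.subset_univ _))
    rw [add_halves] at h1
    refine hf _ _ _ (by positivity) ((contDiff_conj hs).mul (contDiff_character ξ)) h1
      (fun y _ => ?_)
    rw [Submodule.coe_sub, Pi.sub_apply, stftAtom_eq, stftAtom_eq, map_sub, sub_mul]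
  · have : Continuous fun x : Sp d => C * (C' * ‖x - x₀‖ * M.wt ((B / 2)⁻¹ * ‖ξ‖)) := by fun_prop
    simpa using this.tendsto x₀

lemma continuous_localize_stftAtom_right (f : Ultradistribution d M) (χ : UltraD d M)
    {φ : Sp d → ℂ} (hφ : IsGelfandShilov M φ) (x : Sp d) :
    Continuous fun ξ => localize f χ (stftAtom φ hφ x ξ) := by
  rw [continuous_iff_continuousAt]
  intro ξ₀
  set χ' := testMul χ (stftAtom φ hφ x ξ₀) with hχ'
  obtain ⟨B, hB, C, hC, hf⟩ := exists_norm_localize_le f χ'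
  have hK : Bornology.IsBounded (tsupport (χ' : Sp d → ℂ)) := χ'.2.2.isBounded
  obtain ⟨C', hC', hb⟩ := exists_ultraBound_character_sub_one (M := M) hK hB
  rw [ContinuousAt, tendsto_iff_norm_sub_tendsto_zero]
  have hnear : ∀ᶠ ξ in nhds ξ₀, ‖ξ - ξ₀‖ ≤ 1 := by
    have : Continuous fun ξ : Sp d => ‖ξ - ξ₀‖ := by fun_prop
    have h := this.tendsto ξ₀
    simp only [sub_self, norm_zero] at h
    exact h.eventually (ge_mem_nhds zero_lt_one)
  refine squeeze_zero' (g := fun ξ => C * (C' * ‖ξ - ξ₀‖))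
    (Filter.Eventually.of_forall fun _ => norm_nonneg _) (hnear.mono fun ξ hξ => ?_) ?_
  · have e : localize f χ (stftAtom φ hφ x ξ) - localize f χ (stftAtom φ hφ x ξ₀) =
        localize f χ' (characterE M (ξ - ξ₀) - characterE M 0) := by
      rw [← map_sub]
      refine localize_congr f _ _ _ _ fun y => ?_
      have h1 : character ξ y = character ξ₀ y * character (ξ - ξ₀) y := by
        rw [← character_add, add_sub_cancel]
      have h2 : character (0 : Sp d) y = 1 := by simp [character]
      simp only [Submodule.coe_sub, Pi.sub_apply, stftAtom_eq, hχ', testMul, Pi.mul_apply,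
        characterE, h1, h2]
      ring
    rw [e]
    refine hf _ _ _ (by positivity) ((contDiff_character _).sub contDiff_const) (hb _ hξ)
      (fun y _ => ?_)
    simp [characterE, character]
  · have : Continuous fun ξ : Sp d => C * (C' * ‖ξ - ξ₀‖) := by fun_prop
    simpa using this.tendsto ξ₀

lemma measurable_localize_stftAtom (f : Ultradistribution d M) (χ : UltraD d M)
    {φ : Sp d → ℂ} (hφ : IsGelfandShilov M φ) :
    Measurable fun z : Sp d × Sp d => localize f χ (stftAtom φ hφ z.1 z.2) :=
  MeasureTheory.measurable_uncurry_of_continuous_of_measurable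
    (u := fun x ξ => localize f χ (stftAtom φ hφ x ξ))
    (fun ξ => continuous_localize_stftAtom_left f χ hφ ξ)
    (fun x => (continuous_localize_stftAtom_right f χ hφ x).measurable)

/-! ### Fourier series of functions supported in a ball -/

/-- Paley–Wiener type decay of the Fourier integral of a compactly supported ultradifferentiable
function. -/
lemma norm_integral_mul_character_le {K : Set (Sp d)} (hK : IsCompact K) {c B : ℝ}
    (hB : 0 < B) {g : Sp d → ℂ} (hg : ContDiff ℝ (⊤ : ℕ∞) g) (hgK : tsupport g ⊆ K)
    (hb : UltraBound M K c B g) (ξ : Sp d) :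
    ‖∫ y, g y * character ξ y‖ ≤
      MeasureTheory.volume.real K * c * (M.wt (B⁻¹ * ‖ξ‖))⁻¹ := by
  have hcs : HasCompactSupport g := hK.of_isClosed_subset (isClosed_tsupport g) hgK
  have hint : ∀ n : ℕ, (n : ℕ∞) ≤ (⊤ : ℕ∞) → MeasureTheory.Integrable (iteratedFDeriv ℝ n g) :=
    fun n _ => (hg.continuous_iteratedFDeriv (mod_cast le_top)).integrable_of_hasCompactSupport
      (hcs.iteratedFDeriv n)
  set w : Sp d := (2 * Real.pi)⁻¹ • ξ with hw
  have hpi : (0 : ℝ) < 2 * Real.pi := by positivity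
  have hF : FourierTransform.fourier g w = ∫ y, g y * character ξ y := by
    rw [Real.fourier_eq']
    refine MeasureTheory.integral_congr_ae (Filter.Eventually.of_forall fun y => ?_)
    simp only [smul_eq_mul]
    rw [mul_comm, character, hw, inner_smul_right, real_inner_comm]
    congr 2
    push_cast
    field_simp
  have hw' : ∀ n : ℕ, ‖∫ y, g y * character ξ y‖ * ‖ξ‖ ^ n ≤
      MeasureTheory.volume.real K * (c * (B ^ n * M.seq n)) := by
    intro n
    have h1 := congrFun (Real.fourier_iteratedFDeriv hg hint (n := n) le_top) w
    have h2 : ‖FourierTransform.fourier (iteratedFDeriv ℝ n g) w‖ ≤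
        MeasureTheory.volume.real K * (c * (B ^ n * M.seq n)) := by
      rw [Real.fourier_eq]
      refine (MeasureTheory.norm_integral_le_integral_norm _).trans ?_
      simp only [Circle.norm_smul]
      have h3 : ∀ y, y ∉ K → ‖iteratedFDeriv ℝ n g y‖ = 0 := fun y hy => by
        rw [norm_eq_zero]
        by_contra hne
        exact hy (hgK (support_iteratedFDeriv_subset (𝕜 := ℝ) n hne))
      rw [← MeasureTheory.setIntegral_eq_integral_of_forall_compl_eq_zero h3]
      have h4 := MeasureTheory.setIntegral_mono_on (s := K) (μ := MeasureTheory.volume)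
        (hint n le_top).norm.integrableOn
        (MeasureTheory.integrableOn_const (C := c * (B ^ n * M.seq n)) hK.measure_lt_top.ne)
        hK.measurableSet (fun y hy => hb n y hy)
      rwa [MeasureTheory.setIntegral_const, smul_eq_mul] at h4
    rcases eq_or_ne ξ 0 with rfl | hξ
    · rcases Nat.eq_zero_or_pos n with rfl | hn
      · rw [pow_zero, mul_one, ← hF]
        refine le_trans ?_ h2
        rw [h1]
        have h5 := (VectorFourier.fourierPowSMulRight (-innerSL ℝ) (FourierTransform.fourier g)
          w 0).le_opNorm (fun _ => w)
        simpa [VectorFourier.fourierPowSMulRight_apply] using h5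
      · rw [norm_zero, zero_pow hn.ne', mul_zero]
        exact (norm_nonneg _).trans h2
    -- evaluate the `n`-linear map `𝓕 (D^n g) (w)` at `(w, …, w)`
    have h5 := (VectorFourier.fourierPowSMulRight (-innerSL ℝ) (FourierTransform.fourier g)
        w n).le_opNorm (fun _ => w)
    rw [VectorFourier.fourierPowSMulRight_apply] at h5
    simp only [norm_smul, Finset.prod_const, Finset.card_univ, Fintype.card_fin, norm_pow, norm_neg,
      norm_mul, Complex.norm_I, Complex.norm_real, RCLike.norm_ofNat, Real.norm_eq_abs,
      neg_apply, mul_one, abs_of_pos Real.pi_pos] at h5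
    rw [innerSL_apply_apply, real_inner_self_eq_norm_sq, abs_of_nonneg (sq_nonneg _)] at h5
    rw [← h1] at h5
    have hwpos : 0 < ‖w‖ ^ n := by
      have : w ≠ 0 := smul_ne_zero (inv_ne_zero hpi.ne') hξ
      positivity
    have hnw : ‖ξ‖ = 2 * Real.pi * ‖w‖ := by
      rw [hw, norm_smul, Real.norm_of_nonneg (by positivity)]
      field_simp
    refine le_trans (le_of_mul_le_mul_right ?_ hwpos) h2
    rw [hnw, ← hF]
    calc _ = (2 * Real.pi) ^ n * ((‖w‖ ^ 2) ^ n * ‖FourierTransform.fourier g w‖) := by ring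
      _ ≤ _ := h5
  rw [← div_eq_mul_inv, le_div_iff₀ (M.wt_pos _)]
  refine M.mul_wt_le (by positivity) (norm_nonneg _) fun n => ?_
  rw [mul_pow, inv_pow, mul_left_comm, inv_mul_le_iff₀ (by positivity)]
  refine (hw' n).trans (le_of_eq (by ring))

/-- The Fourier coefficients of `g` with respect to the characters of frequency in `τ ℤ^d`; they
are the coefficients of the `2π/τ`-periodization of `g`. -/
def latticeCoeff (τ : ℝ) (g : Sp d → ℂ) (k : Fin d → ℤ) : ℂ :=
  ((τ / (2 * Real.pi)) ^ d : ℝ) * ∫ y, g y * character (-latticePoint τ k) y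

lemma mFourier_coe_eq_character (n : Fin d → ℤ) {τ : ℝ} (hτ : 0 < τ) (x : Fin d → ℝ) :
    UnitAddTorus.mFourier n (fun i => (x i : UnitAddCircle)) =
      character (latticePoint τ n) (-(2 * Real.pi / τ) • WithLp.toLp 2 x) := by
  simp only [UnitAddTorus.mFourier, ContinuousMap.coe_mk, fourier_coe_apply]
  rw [← Complex.exp_sum, character]
  congr 1
  rw [PiLp.inner_apply]
  push_cast
  rw [Finset.mul_sum]
  refine Finset.sum_congr rfl fun i _ => ?_
  have : (τ : ℂ) ≠ 0 := by exact_mod_cast hτ.ne'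
  simp [latticePoint]
  field_simp

/-- A continuous function supported in a ball which embeds in the torus `ℝ^d / (2π/τ) ℤ^d` is on
that ball the sum of its Fourier series, provided the series converges absolutely. -/
lemma hasSum_latticeCoeff {τ R : ℝ} (hτ : 0 < τ) (hR : R < Real.pi / τ) {g : Sp d → ℂ}
    (hg : Continuous g) (hgR : ∀ y, R < ‖y‖ → g y = 0) (hs : Summable (latticeCoeff τ g))
    {y : Sp d} (hy : ‖y‖ ≤ R) :
    HasSum (fun k => latticeCoeff τ g k * character (latticePoint τ k) y) (g y) := by
  set L : ℝ := 2 * Real.pi / τ with hL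
  have hLpos : 0 < L := by positivity
  have hRL : R < L * (1 / 2) := by
    rw [hL]; convert hR using 1; ring
  have hcoord : ∀ (z : Sp d) i, |z i| ≤ ‖z‖ := fun z i => by
    simpa using PiLp.norm_apply_le z i
  -- the transplant of `g` to the torus
  set G : UnitAddTorus (Fin d) → ℂ := fun t =>
    g (-L • WithLp.toLp 2 fun i => (AddCircle.equivIoc 1 (-1 / 2) (t i) : ℝ)) with hG
  have hGcont : Continuous G := by
    rw [continuous_iff_continuousAt]
    intro t
    by_cases ht : ∀ i, t i ≠ ((-1 / 2 : ℝ) : UnitAddCircle)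
    · have h1 : ContinuousAt (fun t : UnitAddTorus (Fin d) => fun i =>
          (AddCircle.equivIoc 1 (-1 / 2) (t i) : ℝ)) t := by
        refine continuousAt_pi.2 fun i => ?_
        have h2 := continuous_subtype_val.continuousAt.comp
          (AddCircle.continuousAt_equivIoc 1 (-1 / 2 : ℝ) (ht i))
        exact ContinuousAt.comp (f := fun s : UnitAddTorus (Fin d) => s i) h2
          (continuous_apply i).continuousAt
      have h3 : Continuous fun x : Fin d → ℝ => g (-L • WithLp.toLp 2 x) :=
        hg.comp (by fun_prop)
      exact h3.continuousAt.comp h1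
    · push Not at ht
      obtain ⟨i, hi⟩ := ht
      have hnorm : ‖t i‖ = 1 / 2 := by
        rw [hi, (AddCircle.norm_coe_eq_abs_iff 1 one_ne_zero).2 (by norm_num)]
        norm_num
      have hopen : IsOpen {s : UnitAddTorus (Fin d) | R < L * ‖s i‖} :=
        isOpen_lt continuous_const (continuous_const.mul (continuous_apply i).norm)
      have hmem : t ∈ {s : UnitAddTorus (Fin d) | R < L * ‖s i‖} := by
        simpa only [Set.mem_ofPred_eq, hnorm] using hRL
      have hz : G =ᶠ[nhds t] fun _ => 0 := by
        filter_upwards [hopen.mem_nhds hmem] with s hs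
        refine hgR _ (lt_of_lt_of_le (lt_of_lt_of_le hs ?_) (hcoord _ i))
        set r := AddCircle.equivIoc (1 : ℝ) (-1 / 2) (s i) with hr
        have h4 : ‖s i‖ = |(r : ℝ)| := by
          rw [← AddCircle.coe_equivIoc (p := (1 : ℝ)) (a := -1 / 2) (y := s i),
            AddCircle.norm_coe_eq_abs_iff 1 one_ne_zero]
          have := r.2
          rw [abs_one, abs_le]
          constructor <;> linarith [this.1, this.2]
        rw [h4]
        simp [abs_mul, abs_of_pos hLpos, ← hr]
      exact (continuousAt_const.congr hz.symm)
  have hGval : ∀ x : Fin d → ℝ, (∀ i, x i ∈ Set.Ioc (-1 / 2 : ℝ) (-1 / 2 + 1)) →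
      G (fun i => (x i : UnitAddCircle)) = g (-L • WithLp.toLp 2 x) := by
    intro x hx
    simp only [hG, AddCircle.equivIoc_coe_of_mem (hx _)]
  have hcoeff : ∀ n, UnitAddTorus.mFourierCoeff G n = latticeCoeff τ g n := by
    intro n
    rw [UnitAddTorus.mFourierCoeff_eq_integral G n (fun _ => -1 / 2)]
    set F : Sp d → ℂ := fun z => g z * character (-latticePoint τ n) z with hF
    have h1 : ∀ x ∈ {x : Fin d → ℝ | ∀ i, x i ∈ Set.Ioc (-1 / 2 : ℝ) (-1 / 2 + 1)},
        UnitAddTorus.mFourier (-n) (fun i => (x i : UnitAddCircle)) •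
          G (fun i => (x i : UnitAddCircle)) = F (-L • WithLp.toLp 2 x) := by
      intro x hx
      rw [hGval x hx, mFourier_coe_eq_character (-n) hτ, latticePoint_neg, smul_eq_mul, mul_comm]
    have hmeas : MeasurableSet
        {x : Fin d → ℝ | ∀ i, x i ∈ Set.Ioc (-1 / 2 : ℝ) (-1 / 2 + 1)} :=
      MeasurableSet.univ_pi' fun i => measurableSet_Ioc
    rw [MeasureTheory.setIntegral_congr_fun hmeas h1,
      MeasureTheory.setIntegral_eq_integral_of_forall_compl_eq_zero]
    · have h2 := (EuclideanSpace.volume_preserving_symm_measurableEquiv_toLp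
        (Fin d)).symm.integral_comp' (fun z => F (-L • z))
      have h3 : ∫ x : Fin d → ℝ, F (-L • WithLp.toLp 2 x) = ∫ z : Sp d, F (-L • z) := h2
      rw [h3, MeasureTheory.Measure.integral_comp_smul, latticeCoeff, finrank_euclideanSpace_fin,
        Complex.real_smul]
      congr 2
      rw [abs_inv, abs_pow, abs_neg, abs_of_pos hLpos, hL, ← inv_pow, inv_div]
    · intro x hx
      have h4 : g (-L • WithLp.toLp 2 x) = 0 := by
        simp only [Set.mem_ofPred_eq, not_forall, Set.mem_Ioc, not_and_or, not_lt, not_le] at hx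
        obtain ⟨i, hi⟩ := hx
        have h5 : 1 / 2 ≤ |x i| := by
          rcases hi with hi | hi
          · rw [le_abs]; right; linarith
          · rw [le_abs]; left; linarith
        refine hgR _ (lt_of_lt_of_le hRL ((mul_le_mul_of_nonneg_left h5 hLpos.le).trans
          (le_trans (le_of_eq ?_) (hcoord _ i))))
        simp [abs_mul, abs_of_pos hLpos]
      simp only [hF, h4, zero_mul]
  have hs' : Summable (UnitAddTorus.mFourierCoeff G) := by
    rw [show UnitAddTorus.mFourierCoeff G = latticeCoeff τ g from funext hcoeff]
    exact hs
  set x : Fin d → ℝ := fun i => -L⁻¹ * y i with hx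
  have hxy : -L • WithLp.toLp 2 x = y := by
    ext i
    simp [hx, hLpos.ne']
  have hxmem : ∀ i, x i ∈ Set.Ioc (-1 / 2 : ℝ) (-1 / 2 + 1) := by
    intro i
    have h1 : |x i| < 1 / 2 := by
      rw [hx, abs_mul, abs_neg, abs_of_pos (inv_pos.2 hLpos), inv_mul_lt_iff₀ hLpos]
      exact lt_of_le_of_lt ((hcoord y i).trans hy) hRL
    rw [abs_lt] at h1
    constructor <;> linarith [h1.1, h1.2]
  have h := UnitAddTorus.hasSum_mFourier_series_apply_of_summable (f := ⟨G, hGcont⟩) hs'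
    (fun i => (x i : UnitAddCircle))
  simp only [ContinuousMap.coe_mk] at h
  rw [hGval x hxmem, hxy] at h
  refine h.congr_fun fun k => ?_
  rw [hcoeff, mFourier_coe_eq_character k hτ, hxy, smul_eq_mul]

/-- Decay of the Fourier coefficients of an ultradifferentiable function supported in `K`. -/
lemma norm_latticeCoeff_le {τ : ℝ} (hτ : 0 < τ) {K : Set (Sp d)} (hK : IsCompact K) {c B : ℝ}
    (hB : 0 < B) {g : Sp d → ℂ} (hg : ContDiff ℝ (⊤ : ℕ∞) g) (hgK : tsupport g ⊆ K)
    (hb : UltraBound M K c B g) (k : Fin d → ℤ) :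
    ‖latticeCoeff τ g k‖ ≤ (τ / (2 * Real.pi)) ^ d * MeasureTheory.volume.real K * c *
      (M.wt (B⁻¹ * ‖latticePoint τ k‖))⁻¹ := by
  rw [latticeCoeff, norm_mul, Complex.norm_real, Real.norm_of_nonneg (by positivity)]
  have h := norm_integral_mul_character_le hK hB hg hgK hb (-latticePoint τ k)
  rw [norm_neg] at h
  calc _ ≤ (τ / (2 * Real.pi)) ^ d * (MeasureTheory.volume.real K * c *
        (M.wt (B⁻¹ * ‖latticePoint τ k‖))⁻¹) := by gcongr
    _ = _ := by ring

/-! ### The change of window -/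

lemma inv_mul_le_mul_inv_of_mul_le {a b c h : ℝ} (hb : 0 < b) (hh : 0 < h) (H : a * b ≤ c * h) :
    h⁻¹ * a ≤ c * b⁻¹ := by
  rw [inv_mul_le_iff₀ hh, ← mul_assoc, ← div_eq_mul_inv, le_div_iff₀ hb]
  linarith

/-- Decay of the Fourier coefficients of `χ ψ`, in terms of bounds for `ψ` on the support of `χ`. -/
lemma exists_norm_latticeCoeff_mul_le (χ : UltraD d M) {τ h : ℝ} (hτ : 0 < τ) (hh : 0 < h) :
    ∃ C, 0 ≤ C ∧ ∀ (ψ : Sp d → ℂ) (c : ℝ), 0 ≤ c → ContDiff ℝ (⊤ : ℕ∞) ψ →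
      UltraBound M (tsupport (χ : Sp d → ℂ)) c (h⁻¹ / 2) ψ → ∀ k,
        ‖latticeCoeff τ ((χ : Sp d → ℂ) * ψ) k‖ ≤ C * c * (M.wt (h * ‖latticePoint τ k‖))⁻¹ := by
  have hK : IsCompact (tsupport (χ : Sp d → ℂ)) := χ.2.2
  obtain ⟨c₀, hc₀, hχ⟩ := χ.2.1.exists_ultraBound hK (B := h⁻¹ / 2) (by positivity)
  refine ⟨(τ / (2 * Real.pi)) ^ d * MeasureTheory.volume.real (tsupport (χ : Sp d → ℂ)) * c₀,
    by positivity, fun ψ c hc hψ hb k => ?_⟩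
  have hb' := UltraBound.mul hc₀ hc (by positivity) (by positivity) χ.2.1.1 hψ hχ hb
  rw [add_halves] at hb'
  have h1 := norm_latticeCoeff_le hτ hK (inv_pos.2 hh) (χ.2.1.1.mul hψ)
    (closure_mono (Function.support_mul_subset_left _ _)) hb' k
  rw [inv_inv] at h1
  refine h1.trans (le_of_eq (by ring))

lemma summable_latticeCoeff_mul_wt (χ : UltraD d M) {τ h : ℝ} (hτ : 0 < τ) (hh : 0 < h) :
    Summable fun k => ‖latticeCoeff τ (χ : Sp d → ℂ) k‖ * M.wt (h * ‖latticePoint τ k‖) := by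
  obtain ⟨A, H, hA, hH, hw⟩ := M.exists_wt_mul_wt_le hh.le hh.le
  obtain ⟨C, hC, hb⟩ := exists_norm_latticeCoeff_mul_le χ hτ hH
  have h1 : UltraBound M (tsupport (χ : Sp d → ℂ)) 1 (H⁻¹ / 2) (fun _ => (1 : ℂ)) := by
    intro n y _
    have := M.pos n
    rcases Nat.eq_zero_or_pos n with rfl | hn
    · simp [M.zero]
    · rw [iteratedFDeriv_const_of_ne hn.ne']
      simp only [Pi.zero_apply, norm_zero]
      positivity
  have h2 := hb _ 1 zero_le_one contDiff_const h1
  have e : (χ : Sp d → ℂ) * (fun _ : Sp d => (1 : ℂ)) = (χ : Sp d → ℂ) := by funext y; simp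
  rw [e] at h2
  refine Summable.of_nonneg_of_le (fun k => mul_nonneg (norm_nonneg _) (M.wt_pos _).le)
    (fun k => ?_) ((M.summable_inv_wt_latticePoint d hh hτ).mul_left (C * A))
  have h3 := hw ‖latticePoint τ k‖ (norm_nonneg _)
  have p1 := M.wt_pos (h * ‖latticePoint τ k‖)
  have p2 := M.wt_pos (H * ‖latticePoint τ k‖)
  calc ‖latticeCoeff τ (χ : Sp d → ℂ) k‖ * M.wt (h * ‖latticePoint τ k‖)
      ≤ C * 1 * (M.wt (H * ‖latticePoint τ k‖))⁻¹ * M.wt (h * ‖latticePoint τ k‖) := by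
        gcongr; exact h2 k
    _ ≤ C * A * (M.wt (h * ‖latticePoint τ k‖))⁻¹ := by
        rw [mul_one, mul_assoc, mul_assoc]
        exact mul_le_mul_of_nonneg_left (inv_mul_le_mul_inv_of_mul_le p1 p2 h3) hC

/-- A localized ultradistribution may be paired with a test function through the Fourier series of
the latter. -/
lemma hasSum_localize_test (f : Ultradistribution d M) (χ₁ χ₂ : UltraD d M) {τ R : ℝ} (hτ : 0 < τ)
    (hR : R < Real.pi / τ) (h₁ : tsupport (χ₁ : Sp d → ℂ) ⊆ Metric.closedBall 0 R)
    (h₂ : tsupport (χ₂ : Sp d → ℂ) ⊆ Metric.closedBall 0 R) :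
    HasSum (fun k => latticeCoeff τ (χ₂ : Sp d → ℂ) k *
      localize f χ₁ (characterE M (latticePoint τ k))) (localize f χ₁ ⟨χ₂, χ₂.2.1⟩) := by
  refine hasSum_localize_character f χ₁ _ _ _
    (fun h hh => summable_latticeCoeff_mul_wt χ₂ hτ hh) fun y hy => ?_
  refine hasSum_latticeCoeff hτ hR χ₂.2.1.1.continuous (fun z hz => ?_) ?_ (by simpa using h₁ hy)
  · by_contra hne
    have := h₂ (subset_closure hne)
    rw [mem_closedBall_zero_iff] at this
    linarith
  · refine Summable.of_norm_bounded (summable_latticeCoeff_mul_wt χ₂ hτ one_pos) fun k => ?_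
    exact le_mul_of_one_le_right (norm_nonneg _) (M.one_le_wt (by positivity))

lemma IsGelfandShilov.exists_norm_le {φ : Sp d → ℂ} (hφ : IsGelfandShilov M φ) :
    ∃ C, 0 ≤ C ∧ ∀ x, ‖φ x‖ ≤ C * (M.wt (1 * ‖x‖))⁻¹ := by
  obtain ⟨C, hC, h⟩ := hφ.exists_wt_mul_le (h := 1) one_pos one_pos
  refine ⟨C, hC, fun x => ?_⟩
  have := h 0 x
  simp only [norm_iteratedFDeriv_zero, pow_zero, M.zero, mul_one] at this
  rw [← div_eq_mul_inv, le_div_iff₀ (M.wt_pos _)]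
  linarith

lemma IsGelfandShilov.integrable_mul_conj {φ : Sp d → ℂ} (hφ : IsGelfandShilov M φ) :
    MeasureTheory.Integrable fun x => φ x * conj (φ x) := by
  obtain ⟨C, hC, h⟩ := hφ.exists_norm_le
  have hcont := hφ.1.continuous
  refine ((M.integrable_inv_wt one_pos).const_mul (C * C)).mono'
    (hcont.mul (Complex.continuous_conj.comp hcont)).aestronglyMeasurable
    (Filter.Eventually.of_forall fun x => ?_)
  have hw := M.wt_pos (1 * ‖x‖)
  have h1 := M.one_le_wt (ρ := 1 * ‖x‖) (by positivity)
  have h2 : (M.wt (1 * ‖x‖))⁻¹ ≤ 1 := inv_le_one_of_one_le₀ h1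
  rw [norm_mul, RCLike.norm_conj]
  calc ‖φ x‖ * ‖φ x‖ ≤ (C * (M.wt (1 * ‖x‖))⁻¹) * (C * (M.wt (1 * ‖x‖))⁻¹) := by
        gcongr <;> exact h x
    _ ≤ (C * (M.wt (1 * ‖x‖))⁻¹) * (C * 1) := by gcongr
    _ = _ := by ring

lemma IsGelfandShilov.integral_mul_conj_ne_zero {φ : Sp d → ℂ} (hφ : IsGelfandShilov M φ)
    (h0 : φ ≠ 0) : ∫ x, φ x * conj (φ x) ≠ 0 := by
  have hint := hφ.integrable_mul_conj
  have e : (fun x => φ x * conj (φ x)) = fun x => ((‖φ x‖ ^ 2 : ℝ) : ℂ) := by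
    funext x; rw [RCLike.mul_conj]; simp
  rw [e] at hint ⊢
  rw [integral_complex_ofReal]
  have hint' : MeasureTheory.Integrable fun x => ‖φ x‖ ^ 2 := by
    have := hint.re
    simpa only [RCLike.re_to_complex, Complex.ofReal_re] using this
  refine Complex.ofReal_ne_zero.2 (ne_of_gt ?_)
  have hcont : Continuous fun x => ‖φ x‖ ^ 2 := hφ.1.continuous.norm.pow 2
  rw [MeasureTheory.integral_pos_iff_support_of_nonneg (fun x => by positivity) hint']
  refine hcont.isOpen_support.measure_pos _ ?_
  obtain ⟨x, hx⟩ := Function.ne_iff.1 h0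
  refine ⟨x, ?_⟩
  simpa using hx

/-- The product `φ₁(· - x') conj φ₂(· - x)` of two translated windows. -/
def windowProd (φ₁ φ₂ : Sp d → ℂ) (hφ₁ : IsGelfandShilov M φ₁) (hφ₂ : IsGelfandShilov M φ₂)
    (x x' : Sp d) : UltraE d M :=
  ⟨fun y => φ₁ (y - x') * conj (φ₂ (y - x)),
    (hφ₁.isUltraDiff.comp_sub x').mul (hφ₂.isUltraDiff.comp_sub x).conj_comp⟩

/-- The Fourier coefficients of `χ φ₁(· - x') conj φ₂(· - x)` decay rapidly in all variables. -/
lemma exists_norm_latticeCoeff_windowProd_le (χ : UltraD d M) {φ₁ φ₂ : Sp d → ℂ}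
    (hφ₁ : IsGelfandShilov M φ₁) (hφ₂ : IsGelfandShilov M φ₂) {τ h h' : ℝ} (hτ : 0 < τ)
    (hh : 0 < h) (hh' : 0 < h') :
    ∃ C, 0 ≤ C ∧ ∀ x x' k,
      ‖latticeCoeff τ (testMul χ (windowProd φ₁ φ₂ hφ₁ hφ₂ x x') : Sp d → ℂ) k‖ ≤
        C * (M.wt (h' * ‖x‖))⁻¹ * (M.wt (h' * ‖x'‖))⁻¹ * (M.wt (h * ‖latticePoint τ k‖))⁻¹ := by
  have hK : Bornology.IsBounded (tsupport (χ : Sp d → ℂ)) := χ.2.2.isBounded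
  obtain ⟨C, hC, hb⟩ := exists_norm_latticeCoeff_mul_le χ hτ hh
  obtain ⟨C₁, hC₁, hb₁⟩ := hφ₁.exists_ultraBound_translate hK hh' (B := h⁻¹ / 2 / 2)
    (by positivity)
  obtain ⟨C₂, hC₂, hb₂⟩ := hφ₂.exists_ultraBound_translate hK hh' (B := h⁻¹ / 2 / 2)
    (by positivity)
  refine ⟨C * C₁ * C₂, by positivity, fun x x' k => ?_⟩
  have w1 := M.wt_pos (h' * ‖x‖)
  have w2 := M.wt_pos (h' * ‖x'‖)
  have h1 := UltraBound.mul (by positivity) (by positivity) (by positivity) (by positivity)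
    (contDiff_window hφ₁ x') (contDiff_conj (contDiff_window hφ₂ x)) (hb₁ x') (hb₂ x).conj
  rw [add_halves] at h1
  have h2 := hb _ _ (by positivity) ((contDiff_window hφ₁ x').mul
    (contDiff_conj (contDiff_window hφ₂ x))) h1 k
  exact h2.trans (le_of_eq (by ring))

/-- Fubini's theorem for the Fourier coefficients of `H |φ(· - x')|²`. -/
lemma integrable_latticeCoeff_mul_window {φ : Sp d → ℂ} (hφ : IsGelfandShilov M φ) {τ : ℝ}
    {H : Sp d → ℂ} (hH : Continuous H) (hHc : HasCompactSupport H) (k : Fin d → ℤ) :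
    MeasureTheory.Integrable (fun x' =>
      latticeCoeff τ (fun y => H y * (φ (y - x') * conj (φ (y - x')))) k) ∧
    ∫ x', latticeCoeff τ (fun y => H y * (φ (y - x') * conj (φ (y - x')))) k =
      (∫ x, φ x * conj (φ x)) * latticeCoeff τ H k := by
  have hchar : Continuous (character (-latticePoint τ k)) := (contDiff_character _).continuous
  have hH' : MeasureTheory.Integrable fun y => H y * character (-latticePoint τ k) y :=
    (hH.mul hchar).integrable_of_hasCompactSupport hHc.mul_right
  have hφ' : MeasureTheory.Integrable fun z => φ (-z) * conj (φ (-z)) :=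
    hφ.integrable_mul_conj.comp_neg
  have hprod := hH'.convolution_integrand (ContinuousLinearMap.mul ℝ ℂ) hφ'
  have e : ∀ x', ∫ y, H y * (φ (y - x') * conj (φ (y - x'))) * character (-latticePoint τ k) y =
      ∫ y, ContinuousLinearMap.mul ℝ ℂ (H y * character (-latticePoint τ k) y)
        (φ (-(x' - y)) * conj (φ (-(x' - y)))) := fun x' =>
    MeasureTheory.integral_congr_ae (Filter.Eventually.of_forall fun y => by
      simp only [ContinuousLinearMap.mul_apply', neg_sub]; ring)
  simp only [latticeCoeff, e]
  refine ⟨hprod.integral_prod_left.const_mul _, ?_⟩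
  rw [MeasureTheory.integral_const_mul, MeasureTheory.integral_integral_swap hprod,
    mul_left_comm, ← MeasureTheory.integral_const_mul (∫ x, φ x * conj (φ x))]
  congr 1
  refine MeasureTheory.integral_congr_ae (Filter.Eventually.of_forall fun y => ?_)
  simp only [ContinuousLinearMap.mul_apply', neg_sub]
  rw [MeasureTheory.integral_const_mul,
    MeasureTheory.integral_sub_left_eq_self (fun z => φ z * conj (φ z)), mul_comm]

/-- **Change of window.**  It rests on the identity
`‖φ₁‖² χ conj φ₂(· - x) = ∫ conj φ₁(· - x') [χ φ₁(· - x') conj φ₂(· - x)] dx'`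
with the bracket expanded in its Fourier series.  To move the functional under the integral sign,
the whole integrand is expanded in a Fourier series as well. -/
lemma integral_mul_localize_stftAtom (f : Ultradistribution d M) (χ : UltraD d M)
    {φ₁ φ₂ : Sp d → ℂ} (hφ₁ : IsGelfandShilov M φ₁) (hφ₂ : IsGelfandShilov M φ₂) {τ R : ℝ}
    (hτ : 0 < τ) (hR : R < Real.pi / τ) (hχ : tsupport (χ : Sp d → ℂ) ⊆ Metric.closedBall 0 R)
    (x ξ : Sp d) :
    (∫ z, φ₁ z * conj (φ₁ z)) *
        localize f (testMul χ ⟨χ, χ.2.1⟩) (stftAtom φ₂ hφ₂ x ξ) =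
      ∫ x', ∑' k, latticeCoeff τ (testMul χ (windowProd φ₁ φ₂ hφ₁ hφ₂ x x') : Sp d → ℂ) k *
        localize f χ (stftAtom φ₁ hφ₁ x' (ξ + latticePoint τ k)) := by
  have hsub : ∀ g : UltraE d M, tsupport (testMul χ g : Sp d → ℂ) ⊆ Metric.closedBall 0 R :=
    fun g => (closure_mono (Function.support_mul_subset_left _ _)).trans hχ
  set χξ : UltraD d M := testMul χ (characterE M ξ) with hχξ
  set g : UltraD d M := testMul χ (windowE φ₂ hφ₂ x) with hg
  set b : Sp d → UltraD d M := fun x' => testMul χ (windowProd φ₁ φ₂ hφ₁ hφ₂ x x') with hb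
  set G : Sp d → UltraD d M := fun x' =>
    testMul (b x') (windowE φ₁ hφ₁ x') with hG
  set u : (Fin d → ℤ) → ℂ := fun k => localize f χξ (characterE M (latticePoint τ k)) with hu
  have hGsupp : ∀ x', tsupport (G x' : Sp d → ℂ) ⊆ Metric.closedBall 0 R := fun x' =>
    (closure_mono (Function.support_mul_subset_left _ _)).trans (hsub _)
  have hGform : ∀ x', (G x' : Sp d → ℂ) = fun y => (g : Sp d → ℂ) y *
      (φ₁ (y - x') * conj (φ₁ (y - x'))) := by
    intro x'
    funext y
    simp only [hG, hb, hg, testMul, windowProd, windowE, Pi.mul_apply]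
    ring
  -- both expansions of the integrand
  have h1 : ∀ x', ∑' k, latticeCoeff τ (b x' : Sp d → ℂ) k *
      localize f χ (stftAtom φ₁ hφ₁ x' (ξ + latticePoint τ k)) =
      localize f χξ ⟨G x', (G x').2.1⟩ := by
    intro x'
    have h := hasSum_localize_test f (testMul χ (stftAtom φ₁ hφ₁ x' ξ)) (b x') hτ hR
      (hsub _) (hsub _)
    have e1 : ∀ k, localize f (testMul χ (stftAtom φ₁ hφ₁ x' ξ))
        (characterE M (latticePoint τ k)) =
        localize f χ (stftAtom φ₁ hφ₁ x' (ξ + latticePoint τ k)) := fun k => by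
      refine localize_congr f _ _ _ _ fun y => ?_
      simp only [testMul, Pi.mul_apply, stftAtom_eq, characterE, character_add]
      ring
    have e2 : localize f (testMul χ (stftAtom φ₁ hφ₁ x' ξ)) ⟨b x', (b x').2.1⟩ =
        localize f χξ ⟨G x', (G x').2.1⟩ := by
      refine localize_congr f _ _ _ _ fun y => ?_
      simp only [testMul, Pi.mul_apply, stftAtom_eq, characterE, hχξ, hG, windowE]
      ring
    simp only [e1, e2] at h
    exact h.tsum_eq
  have h2 : ∀ x', ∑' k, latticeCoeff τ (G x' : Sp d → ℂ) k * u k =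
      localize f χξ ⟨G x', (G x').2.1⟩ := fun x' =>
    (hasSum_localize_test f χξ (G x') hτ hR (hsub _) (hGsupp x')).tsum_eq
  have h3 : ∑' k, latticeCoeff τ (g : Sp d → ℂ) k * u k = localize f χξ ⟨g, g.2.1⟩ :=
    (hasSum_localize_test f χξ g hτ hR (hsub _) (hsub _)).tsum_eq
  have h4 : localize f (testMul χ ⟨χ, χ.2.1⟩) (stftAtom φ₂ hφ₂ x ξ) =
      localize f χξ ⟨g, g.2.1⟩ := by
    refine localize_congr f _ _ _ _ fun y => ?_
    simp only [testMul, Pi.mul_apply, stftAtom_eq, characterE, hχξ, hg, windowE]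
    ring
  have hcoeff := fun k => integrable_latticeCoeff_mul_window hφ₁ (τ := τ)
    g.2.1.1.continuous g.2.2 k
  simp only [← hGform] at hcoeff
  -- growth of the pairings with characters, decay of the Fourier coefficients
  obtain ⟨C, a, hC, ha, hua⟩ : ∃ C a : ℝ, 0 ≤ C ∧ 0 < a ∧
      ∀ k, ‖u k‖ ≤ C * M.wt (a * ‖latticePoint τ k‖) := by
    obtain ⟨B, hB, C, hC, hf⟩ := exists_norm_localize_le f χξ
    exact ⟨C, B⁻¹, hC, inv_pos.2 hB, fun k => hf _ _ _ (M.wt_pos _).le (contDiff_character _)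
      ((ultraBound_character hB _).subset (Set.subset_univ _)) fun y _ => rfl⟩
  obtain ⟨C', h, hC', hh, hw⟩ := M.exists_wt_mul_wt_le ha.le ha.le
  obtain ⟨D, hD, hGk⟩ : ∃ D, 0 ≤ D ∧ ∀ x' k, ‖latticeCoeff τ (G x' : Sp d → ℂ) k‖ ≤
      D * (M.wt (1 * ‖x'‖))⁻¹ * (M.wt (h * ‖latticePoint τ k‖))⁻¹ := by
    obtain ⟨D, hD, hDk⟩ := exists_norm_latticeCoeff_windowProd_le g hφ₁ hφ₁ hτ hh one_pos
    refine ⟨D, hD, fun x' k => ?_⟩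
    have h5 := hDk x' x' k
    have e : (testMul g (windowProd φ₁ φ₁ hφ₁ hφ₁ x' x') : Sp d → ℂ) = G x' := (hGform x').symm
    rw [e] at h5
    refine h5.trans ?_
    have p1 := M.wt_pos (1 * ‖x'‖)
    have p2 := M.wt_pos (h * ‖latticePoint τ k‖)
    have p3 : (M.wt (1 * ‖x'‖))⁻¹ ≤ 1 := inv_le_one_of_one_le₀ (M.one_le_wt (by positivity))
    gcongr
    exact mul_le_of_le_one_right hD p3
  have hterm : ∀ x' k, ‖latticeCoeff τ (G x' : Sp d → ℂ) k * u k‖ ≤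
      (D * C * C' * (M.wt (a * ‖latticePoint τ k‖))⁻¹) * (M.wt (1 * ‖x'‖))⁻¹ := by
    intro x' k
    have p1 := M.wt_pos (1 * ‖x'‖)
    have p2 := M.wt_pos (h * ‖latticePoint τ k‖)
    have p3 := M.wt_pos (a * ‖latticePoint τ k‖)
    have p4 := hw ‖latticePoint τ k‖ (norm_nonneg _)
    rw [norm_mul]
    calc _ ≤ (D * (M.wt (1 * ‖x'‖))⁻¹ * (M.wt (h * ‖latticePoint τ k‖))⁻¹) *
          (C * M.wt (a * ‖latticePoint τ k‖)) := by
          gcongr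
          · exact hGk x' k
          · exact hua k
      _ = (D * C * (M.wt (1 * ‖x'‖))⁻¹) *
          ((M.wt (h * ‖latticePoint τ k‖))⁻¹ * M.wt (a * ‖latticePoint τ k‖)) := by ring
      _ ≤ (D * C * (M.wt (1 * ‖x'‖))⁻¹) * (C' * (M.wt (a * ‖latticePoint τ k‖))⁻¹) := by
          exact mul_le_mul_of_nonneg_left (inv_mul_le_mul_inv_of_mul_le p3 p2 p4) (by positivity)
      _ = _ := by ring
  have hw1 := M.integrable_inv_wt (d := d) one_pos
  have hint : ∀ k, MeasureTheory.Integrable fun x' => latticeCoeff τ (G x' : Sp d → ℂ) k * u k :=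
    fun k => (hcoeff k).1.mul_const _
  have hsum : Summable fun k => ∫ x', ‖latticeCoeff τ (G x' : Sp d → ℂ) k * u k‖ := by
    refine Summable.of_nonneg_of_le
      (fun k => MeasureTheory.integral_nonneg fun x' => norm_nonneg _)
      (fun k => (MeasureTheory.integral_mono (hint k).norm (hw1.const_mul _)
        (fun x' => hterm x' k)).trans (le_of_eq (MeasureTheory.integral_const_mul _ _)))
      (((M.summable_inv_wt_latticePoint d ha hτ).mul_left (D * C * C')).mul_right _)
  have h6 := MeasureTheory.hasSum_integral_of_summable_integral_norm hint hsum
  rw [h4, ← h3, ← tsum_mul_left]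
  refine Eq.trans ?_ (MeasureTheory.integral_congr_ae
    (Filter.Eventually.of_forall fun x' => (h2 x').trans (h1 x').symm))
  rw [← h6.tsum_eq]
  refine tsum_congr fun k => ?_
  rw [MeasureTheory.integral_mul_const, (hcoeff k).2]
  ring

/-! ### Discrete convolution and cones -/

/-- Minkowski's inequality for countable sums of nonnegative functions. -/
lemma eLpNorm_tsum_le {α ι : Type*} [MeasurableSpace α] {μ : MeasureTheory.Measure α} [Countable ι]
    {F : ι → α → ℝ≥0∞} (hF : ∀ i, Measurable (F i)) {q : ℝ≥0∞} (hq : 1 ≤ q) :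
    MeasureTheory.eLpNorm (fun x => ∑' i, F i x) q μ ≤
      ∑' i, MeasureTheory.eLpNorm (F i) q μ := by
  rcases eq_or_ne q ∞ with rfl | hq'
  · simp only [MeasureTheory.eLpNorm_exponent_top]
    refine MeasureTheory.eLpNormEssSup_le_of_ae_enorm_bound ?_
    have h : ∀ᵐ x ∂μ, ∀ i, ‖F i x‖ₑ ≤ MeasureTheory.eLpNormEssSup (F i) μ :=
      MeasureTheory.ae_all_iff.2 fun i => MeasureTheory.enorm_ae_le_eLpNormEssSup (F i) μ
    filter_upwards [h] with x hx
    exact ENNReal.tsum_le_tsum hx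
  have hq0 : q ≠ 0 := (zero_lt_one.trans_le hq).ne'
  have hpos : 0 < q.toReal := ENNReal.toReal_pos hq0 hq'
  have hfin : ∀ s : Finset ι, ∫⁻ x, (∑ i ∈ s, F i x) ^ q.toReal ∂μ ≤
      (∑' i, MeasureTheory.eLpNorm (F i) q μ) ^ q.toReal := by
    intro s
    have h1 := (MeasureTheory.eLpNorm_sum_le (μ := μ) (s := s) (f := F)
      (fun i _ => (hF i).aestronglyMeasurable) hq).trans (ENNReal.sum_le_tsum s)
    rw [MeasureTheory.eLpNorm_eq_lintegral_rpow_enorm_toReal hq0 hq', one_div,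
      ENNReal.rpow_inv_le_iff hpos] at h1
    simpa only [Finset.sum_apply, enorm_eq_self] using h1
  rw [MeasureTheory.eLpNorm_eq_lintegral_rpow_enorm_toReal hq0 hq', one_div,
    ENNReal.rpow_inv_le_iff hpos]
  have h2 : ∀ x, ‖∑' i, F i x‖ₑ ^ q.toReal = ⨆ s : Finset ι, (∑ i ∈ s, F i x) ^ q.toReal := by
    intro x
    rw [enorm_eq_self, ENNReal.tsum_eq_iSup_sum]
    exact (ENNReal.orderIsoRpow q.toReal hpos).map_iSup _
  simp only [h2]
  rw [MeasureTheory.lintegral_iSup_directed]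
  · exact iSup_le hfin
  · exact fun s => (Finset.measurable_fun_sum s fun i _ => hF i).pow_const _ |>.aemeasurable
  · classical
    refine directed_of_isDirected_le fun s t hst x => ?_
    exact ENNReal.rpow_le_rpow (Finset.sum_le_sum_of_subset hst) hpos.le

/-- Around every direction of an open cone `Γ` there is a smaller open cone `Γ'` that keeps a
distance from the complement of `Γ` proportional to the norm. -/
lemma IsOpenCone.exists_subcone {Γ : Set (Sp d)} (hΓ : IsOpenCone Γ) {ξ₀ : Sp d} (hξ₀ : ξ₀ ∈ Γ) :
    ∃ Γ' : Set (Sp d), IsOpenCone Γ' ∧ ξ₀ ∈ Γ' ∧ ∃ r : ℝ, 0 < r ∧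
      ∀ ξ ∈ Γ', ∀ η, η ∉ Γ → r * ‖ξ‖ ≤ ‖η - ξ‖ := by
  have h0 : ξ₀ ≠ 0 := fun h => hΓ.2.1 (h ▸ hξ₀)
  have hn0 : 0 < ‖ξ₀‖ := norm_pos_iff.2 h0
  obtain ⟨ε, hε, hball⟩ := Metric.isOpen_iff.1 hΓ.1 ξ₀ hξ₀
  refine ⟨{ξ | ‖‖ξ₀‖ • ξ - ‖ξ‖ • ξ₀‖ < ε / 2 * ‖ξ‖}, ⟨?_, by simp, ?_⟩, by simp; positivity,
    ε / (2 * ‖ξ₀‖), by positivity, ?_⟩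
  · exact isOpen_lt (by fun_prop) (by fun_prop)
  · intro ξ hξ t ht
    simp only [Set.mem_ofPred_eq] at hξ ⊢
    have e : ‖ξ₀‖ • t • ξ - ‖t • ξ‖ • ξ₀ = t • (‖ξ₀‖ • ξ - ‖ξ‖ • ξ₀) := by
      rw [norm_smul, Real.norm_of_nonneg ht.le, smul_sub, smul_smul, smul_smul, smul_smul,
        mul_comm t ‖ξ₀‖]
    rw [e, norm_smul, norm_smul, Real.norm_of_nonneg ht.le]
    calc t * ‖‖ξ₀‖ • ξ - ‖ξ‖ • ξ₀‖ < t * (ε / 2 * ‖ξ‖) := by gcongr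
      _ = _ := by ring
  · intro ξ hξ η hη
    simp only [Set.mem_ofPred_eq] at hξ
    by_contra hlt
    push Not at hlt
    have hξn : 0 < ‖ξ‖ := by
      by_contra hle
      have : ‖ξ‖ = 0 := le_antisymm (not_lt.1 hle) (norm_nonneg _)
      rw [this, mul_zero] at hξ
      exact absurd hξ (not_lt.2 (norm_nonneg _))
    have hmem : (‖ξ₀‖ / ‖ξ‖) • η ∈ Γ := by
      apply hball
      rw [Metric.mem_ball, dist_eq_norm]
      have e : (‖ξ₀‖ / ‖ξ‖) • η - ξ₀ =
          ‖ξ‖⁻¹ • (‖ξ₀‖ • (η - ξ) + (‖ξ₀‖ • ξ - ‖ξ‖ • ξ₀)) := by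
        rw [smul_sub, sub_add_sub_cancel, smul_sub, smul_smul, smul_smul,
          inv_mul_cancel₀ hξn.ne', one_smul, div_eq_inv_mul]
      rw [e, norm_smul, norm_inv, norm_norm, inv_mul_lt_iff₀ hξn]
      refine (norm_add_le _ _).trans_lt ?_
      rw [norm_smul, norm_norm]
      have h1 : ‖ξ₀‖ * ‖η - ξ‖ < ε / 2 * ‖ξ‖ := by
        calc ‖ξ₀‖ * ‖η - ξ‖ < ‖ξ₀‖ * (ε / (2 * ‖ξ₀‖) * ‖ξ‖) := by gcongr
          _ = _ := by field_simp
      linarith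
    have h2 := hΓ.2.2 _ hmem (‖ξ‖ / ‖ξ₀‖) (by positivity)
    rw [smul_smul, div_mul_div_cancel₀ hn0.ne', div_self hξn.ne', one_smul] at h2
    exact hη h2

/-- Discrete convolution with a rapidly decreasing sequence preserves `L^q`-integrability on cones,
up to shrinking the cone, for functions of at most ultrapolynomial growth: the contribution of the
frequencies outside `Γ` is negligible, because there the shift is comparable with the frequency. -/
lemma exists_cone_eLpNorm_tsum_lt_top (M : WeightSequence) {τ : ℝ} (hτ : 0 < τ) {q : ℝ≥0∞}
    (hq : 1 ≤ q) {Γ : Set (Sp d)} (hΓ : IsOpenCone Γ) {ξ₀ : Sp d} (hξ₀ : ξ₀ ∈ Γ)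
    {G : Sp d → ℝ≥0∞} (hG : Measurable G) {C a : ℝ} (hC : 0 ≤ C) (ha : 0 ≤ a)
    (hgrowth : ∀ ξ, G ξ ≤ ENNReal.ofReal (C * M.wt (a * ‖ξ‖)))
    (hfin : MeasureTheory.eLpNorm G q (MeasureTheory.volume.restrict Γ) < ∞) :
    ∃ Γ' : Set (Sp d), IsOpenCone Γ' ∧ ξ₀ ∈ Γ' ∧ ∃ h : ℝ, 0 < h ∧
      MeasureTheory.eLpNorm (fun ξ => ∑' k : Fin d → ℤ,
        ENNReal.ofReal (M.wt (h * ‖latticePoint τ k‖))⁻¹ * G (ξ + latticePoint τ k)) q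
        (MeasureTheory.volume.restrict Γ') < ∞ := by
  obtain ⟨Γ', hΓ', hξ₀', r, hr, hsep⟩ := hΓ.exists_subcone hξ₀
  obtain ⟨C₁, h₁, hC₁, hh₁, hw₁⟩ := M.exists_wt_mul_wt_le (a := a * (1 + r⁻¹)) (b := r⁻¹)
    (by positivity) (by positivity)
  obtain ⟨C₂, h₂, hC₂, hh₂, hw₂⟩ := M.exists_wt_mul_wt_le hh₁.le zero_le_one
  refine ⟨Γ', hΓ', hξ₀', h₂, hh₂, ?_⟩
  set A : (Fin d → ℤ) → ℝ≥0∞ := fun k => ENNReal.ofReal (M.wt (h₂ * ‖latticePoint τ k‖))⁻¹ with hA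
  set D : (Fin d → ℤ) → ℝ≥0∞ := fun k =>
    ENNReal.ofReal (C * (C₁ * C₂) * (M.wt (1 * ‖latticePoint τ k‖))⁻¹) with hD
  set G₁ : Sp d → ℝ≥0∞ := Γ.indicator G with hG₁
  have hG₁m : Measurable G₁ := hG.indicator hΓ.1.measurableSet
  -- the two regimes `ξ + τ k ∈ Γ` and `ξ + τ k ∉ Γ`
  have hpt : ∀ ξ ∈ Γ', ∀ k, A k * G (ξ + latticePoint τ k) ≤
      A k * G₁ (ξ + latticePoint τ k) + D k * ENNReal.ofReal (M.wt (1 * ‖ξ‖))⁻¹ := by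
    intro ξ hξ k
    by_cases hmem : ξ + latticePoint τ k ∈ Γ
    · rw [hG₁, Set.indicator_of_mem hmem]
      exact le_self_add
    refine le_trans ?_ le_add_self
    set ρ := ‖latticePoint τ k‖ with hρ
    have hρ0 : 0 ≤ ρ := norm_nonneg _
    have h1 : ‖ξ‖ ≤ r⁻¹ * ρ := by
      have := hsep ξ hξ _ hmem
      rw [add_sub_cancel_left] at this
      rw [le_inv_mul_iff₀ hr]
      exact this
    have h2 : ‖ξ + latticePoint τ k‖ ≤ (1 + r⁻¹) * ρ :=
      (norm_add_le _ _).trans (by linarith)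
    have p1 := M.wt_pos (1 * ‖ξ‖)
    have p2 := M.wt_pos (1 * ρ)
    have p3 := M.wt_pos (h₂ * ρ)
    have p4 := M.wt_pos (h₁ * ρ)
    have key : (M.wt (h₂ * ρ))⁻¹ * (C * M.wt (a * ‖ξ + latticePoint τ k‖)) ≤
        C * (C₁ * C₂) * (M.wt (1 * ρ))⁻¹ * (M.wt (1 * ‖ξ‖))⁻¹ := by
      have e1 : M.wt (a * ‖ξ + latticePoint τ k‖) * M.wt (1 * ‖ξ‖) ≤ C₁ * M.wt (h₁ * ρ) := by
        refine le_trans ?_ (hw₁ ρ hρ0)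
        have q1 := M.wt_pos (a * (1 + r⁻¹) * ρ)
        gcongr
        · exact M.wt_mono (by positivity) (by rw [mul_assoc]; gcongr)
        · exact M.wt_mono (by positivity) (by rw [one_mul]; exact h1)
      have e2 := inv_mul_le_mul_inv_of_mul_le p2 p3 (hw₂ ρ hρ0)
      have e3 : M.wt (a * ‖ξ + latticePoint τ k‖) ≤
          C₁ * M.wt (h₁ * ρ) * (M.wt (1 * ‖ξ‖))⁻¹ := by
        rw [← div_eq_mul_inv, le_div_iff₀ p1]; exact e1
      calc (M.wt (h₂ * ρ))⁻¹ * (C * M.wt (a * ‖ξ + latticePoint τ k‖))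
          ≤ (M.wt (h₂ * ρ))⁻¹ * (C * (C₁ * M.wt (h₁ * ρ) * (M.wt (1 * ‖ξ‖))⁻¹)) := by gcongr
        _ = C * C₁ * (M.wt (1 * ‖ξ‖))⁻¹ * ((M.wt (h₂ * ρ))⁻¹ * M.wt (h₁ * ρ)) := by ring
        _ ≤ C * C₁ * (M.wt (1 * ‖ξ‖))⁻¹ * (C₂ * (M.wt (1 * ρ))⁻¹) :=
          mul_le_mul_of_nonneg_left e2 (by positivity)
        _ = _ := by ring
    calc A k * G (ξ + latticePoint τ k)
        ≤ A k * ENNReal.ofReal (C * M.wt (a * ‖ξ + latticePoint τ k‖)) := by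
          gcongr; exact hgrowth _
      _ = ENNReal.ofReal ((M.wt (h₂ * ρ))⁻¹ * (C * M.wt (a * ‖ξ + latticePoint τ k‖))) := by
          exact (ENNReal.ofReal_mul (by positivity)).symm
      _ ≤ ENNReal.ofReal (C * (C₁ * C₂) * (M.wt (1 * ρ))⁻¹ * (M.wt (1 * ‖ξ‖))⁻¹) :=
          ENNReal.ofReal_le_ofReal key
      _ = _ := by rw [hD, ENNReal.ofReal_mul (by positivity)]
  have hAsum : ∑' k, A k < ∞ := by
    have hs := M.summable_inv_wt_latticePoint d hh₂ hτ
    rw [hA, ← ENNReal.ofReal_tsum_of_nonneg (fun k => inv_nonneg.2 (M.wt_pos _).le) hs]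
    exact ENNReal.ofReal_lt_top
  have hDsum : ∑' k, D k < ∞ := by
    have hs := (M.summable_inv_wt_latticePoint d one_pos hτ).mul_left (C * (C₁ * C₂))
    rw [hD, ← ENNReal.ofReal_tsum_of_nonneg
      (fun k => mul_nonneg (by positivity) (inv_nonneg.2 (M.wt_pos _).le)) hs]
    exact ENNReal.ofReal_lt_top
  have hwm : Measurable fun ξ : Sp d => ENNReal.ofReal (M.wt (1 * ‖ξ‖))⁻¹ :=
    (M.measurable_wt_norm 1 zero_le_one).inv.ennreal_ofReal
  have hterm : ∀ k, Measurable fun ξ => A k * G₁ (ξ + latticePoint τ k) := fun k =>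
    (hG₁m.comp (measurable_add_const _)).const_mul _
  have hwfin : MeasureTheory.eLpNorm (fun ξ : Sp d => ENNReal.ofReal (M.wt (1 * ‖ξ‖))⁻¹) q
      MeasureTheory.volume < ∞ := by
    have h1 := eLpNorm_lt_top_of_integrable_of_le_one (M.integrable_inv_wt (d := d) one_pos)
      (fun x => by
        rw [Real.norm_of_nonneg (inv_nonneg.2 (M.wt_pos _).le)]
        exact inv_le_one_of_one_le₀ (M.one_le_wt (by positivity))) hq
    refine lt_of_le_of_lt (MeasureTheory.eLpNorm_mono_enorm_ae
      (Filter.Eventually.of_forall fun x => ?_)) h1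
    rw [enorm_eq_self, Real.enorm_of_nonneg (inv_nonneg.2 (M.wt_pos _).le)]
  have hN : MeasureTheory.eLpNorm G₁ q MeasureTheory.volume < ∞ := by
    rwa [hG₁, MeasureTheory.eLpNorm_indicator_eq_eLpNorm_restrict hΓ.1.measurableSet]
  have hfirst : MeasureTheory.eLpNorm (fun ξ => ∑' k, A k * G₁ (ξ + latticePoint τ k)) q
      MeasureTheory.volume < ∞ := by
    refine lt_of_le_of_lt (eLpNorm_tsum_le hterm hq) ?_
    have h1 : ∀ k, MeasureTheory.eLpNorm (fun ξ => A k * G₁ (ξ + latticePoint τ k)) q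
        MeasureTheory.volume ≤ A k * MeasureTheory.eLpNorm G₁ q MeasureTheory.volume := by
      intro k
      have h2 := MeasureTheory.eLpNorm_comp_measurePreserving (p := q) (g := G₁)
        hG₁m.aestronglyMeasurable
        (MeasureTheory.measurePreserving_add_right MeasureTheory.volume (latticePoint τ k))
      rw [← h2]
      refine MeasureTheory.eLpNorm_le_mul_eLpNorm_of_ae_le_mul'' q
        (hG₁m.comp (measurable_add_const _)).aestronglyMeasurable
        (Filter.Eventually.of_forall fun ξ => ?_)
      simp only [enorm_eq_self, Function.comp_apply]
      exact le_rfl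
    refine lt_of_le_of_lt (ENNReal.tsum_le_tsum h1) ?_
    rw [ENNReal.tsum_mul_right]
    exact ENNReal.mul_lt_top hAsum hN
  have hmono : MeasureTheory.eLpNorm (fun ξ => ∑' k, A k * G (ξ + latticePoint τ k)) q
      (MeasureTheory.volume.restrict Γ') ≤
      MeasureTheory.eLpNorm ((fun ξ => ∑' k, A k * G₁ (ξ + latticePoint τ k)) +
        fun ξ => (∑' k, D k) * ENNReal.ofReal (M.wt (1 * ‖ξ‖))⁻¹) q
      (MeasureTheory.volume.restrict Γ') := by
    refine MeasureTheory.eLpNorm_mono_enorm_ae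
      (MeasureTheory.ae_restrict_of_forall_mem hΓ'.1.measurableSet fun ξ hξ => ?_)
    simp only [enorm_eq_self, Pi.add_apply]
    rw [← ENNReal.tsum_mul_right, ← ENNReal.tsum_add]
    exact ENNReal.tsum_le_tsum (hpt ξ hξ)
  refine hmono.trans_lt (lt_of_le_of_lt (MeasureTheory.eLpNorm_mono_measure _
    MeasureTheory.Measure.restrict_le_self) (lt_of_le_of_lt (MeasureTheory.eLpNorm_add_le
    (Measurable.tsum hterm).aestronglyMeasurable
    (hwm.const_mul _).aestronglyMeasurable hq) (ENNReal.add_lt_top.2 ⟨hfirst, ?_⟩)))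
  refine lt_of_le_of_lt (MeasureTheory.eLpNorm_le_mul_eLpNorm_of_ae_le_mul'' q (c := ∑' k, D k)
    hwm.aestronglyMeasurable (Filter.Eventually.of_forall fun ξ => ?_))
    (ENNReal.mul_lt_top hDsum hwfin)
  simp only [enorm_eq_self]
  exact le_rfl

/-! ### Moderate weights -/

lemma IsModerateWeight.exists_le_mul {ω : Sp d × Sp d → ℝ} (hω : IsModerateWeight M ω) :
    ∃ C : ℝ, 0 < C ∧ ∀ x x' ξ ξ' : Sp d,
      ω (x, ξ) ≤ C * M.wt (2 * ‖x - x'‖) * M.wt (2 * ‖ξ - ξ'‖) * ω (x', ξ') := by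
  obtain ⟨C, hC, h⟩ := hω.moderate
  refine ⟨C, hC, fun x x' ξ ξ' => ?_⟩
  have h1 := h (x - x', ξ - ξ') (x', ξ')
  simp only [Prod.mk_add_mk, sub_add_cancel] at h1
  refine h1.trans (mul_le_mul_of_nonneg_right ?_ (hω.nonneg _))
  rw [mul_assoc]
  refine mul_le_mul_of_nonneg_left ?_ hC.le
  refine le_trans (M.wt_mono (Real.sqrt_nonneg _) ?_)
    (M.wt_add_le (norm_nonneg (x - x')) (norm_nonneg (ξ - ξ')))
  exact Real.sqrt_le_iff.2 ⟨by positivity,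
    by nlinarith [norm_nonneg (x - x'), norm_nonneg (ξ - ξ')]⟩

/-- The supremum of `ω` over unit balls. It is lower semicontinuous, hence Borel measurable together
with all its sections, and comparable with `ω` when `ω` is moderate. -/
def unitBallSup (ω : Sp d × Sp d → ℝ) (z : Sp d × Sp d) : ℝ≥0∞ :=
  ⨆ w ∈ Metric.ball z 1, ENNReal.ofReal (ω w)

lemma measurable_unitBallSup (ω : Sp d × Sp d → ℝ) : Measurable (unitBallSup ω) := by
  refine LowerSemicontinuous.measurable (lowerSemicontinuous_iff_isOpen_preimage.2 fun t => ?_)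
  have : unitBallSup ω ⁻¹' Set.Ioi t =
      ⋃ w ∈ {w | t < ENNReal.ofReal (ω w)}, Metric.ball w 1 := by
    ext z
    simp only [Set.mem_preimage, Set.mem_Ioi, unitBallSup, lt_iSup_iff, Set.mem_iUnion,
      Metric.mem_ball_comm (x := z), exists_prop, Set.mem_ofPred_eq]
    exact exists_congr fun w => and_comm
  rw [this]
  exact isOpen_biUnion fun w _ => Metric.isOpen_ball

lemma le_unitBallSup (ω : Sp d × Sp d → ℝ) (z : Sp d × Sp d) :
    ENNReal.ofReal (ω z) ≤ unitBallSup ω z :=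
  le_iSup₂_of_le z (Metric.mem_ball_self one_pos) le_rfl

lemma IsModerateWeight.exists_unitBallSup_le {ω : Sp d × Sp d → ℝ} (hω : IsModerateWeight M ω) :
    ∃ C : ℝ, 0 < C ∧ ∀ z, unitBallSup ω z ≤ ENNReal.ofReal (C * ω z) := by
  obtain ⟨C, hC, h⟩ := hω.exists_le_mul
  have hw := M.wt_pos (2 * 1)
  refine ⟨C * M.wt (2 * 1) * M.wt (2 * 1), by positivity, fun z =>
    iSup₂_le fun w hw' => ENNReal.ofReal_le_ofReal ((h w.1 z.1 w.2 z.2).trans ?_)⟩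
  have hz := hω.nonneg z
  rw [Metric.mem_ball, dist_eq_norm, Prod.norm_def, max_lt_iff] at hw'
  simp only [Prod.fst_sub, Prod.snd_sub] at hw'
  have p1 := M.wt_pos (2 * ‖w.1 - z.1‖)
  have p2 := M.wt_pos (2 * ‖w.2 - z.2‖)
  have q1 : M.wt (2 * ‖w.1 - z.1‖) ≤ M.wt (2 * 1) :=
    M.wt_mono (by positivity) (by linarith [hw'.1])
  have q2 : M.wt (2 * ‖w.2 - z.2‖) ≤ M.wt (2 * 1) :=
    M.wt_mono (by positivity) (by linarith [hw'.2])
  gcongr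

/-! ### Independence of the exponent and of the window -/

/-- The part of the short-time Fourier transform of `χ f` at frequency `ξ` that controls all other
windows: a weighted `L¹` norm in `x`, whose weight decays like `1 / wt (h ‖x‖)`. -/
def frequencyMass (f : Ultradistribution d M) (χ : UltraD d M) (φ : Sp d → ℂ)
    (hφ : IsGelfandShilov M φ) (ω : Sp d × Sp d → ℝ) (h : ℝ) (ξ : Sp d) : ℝ≥0∞ :=
  ∫⁻ x, ENNReal.ofReal (M.wt (h * ‖x‖))⁻¹ *
    (‖localize f χ (stftAtom φ hφ x ξ)‖ₑ * unitBallSup ω (x, ξ))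

lemma measurable_frequencyMass_integrand (f : Ultradistribution d M) (χ : UltraD d M)
    {φ : Sp d → ℂ} (hφ : IsGelfandShilov M φ) (ω : Sp d × Sp d → ℝ) {h : ℝ} (hh : 0 ≤ h) :
    Measurable fun z : Sp d × Sp d => ENNReal.ofReal (M.wt (h * ‖z.1‖))⁻¹ *
      (‖localize f χ (stftAtom φ hφ z.1 z.2)‖ₑ * unitBallSup ω z) :=
  ((M.measurable_wt_norm h hh).comp measurable_fst).inv.ennreal_ofReal.mul
    ((measurable_localize_stftAtom f χ hφ).enorm.mul (measurable_unitBallSup ω))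

lemma measurable_frequencyMass (f : Ultradistribution d M) (χ : UltraD d M)
    {φ : Sp d → ℂ} (hφ : IsGelfandShilov M φ) (ω : Sp d × Sp d → ℝ) {h : ℝ} (hh : 0 ≤ h) :
    Measurable (frequencyMass f χ φ hφ ω h) :=
  (measurable_frequencyMass_integrand f χ hφ ω hh).lintegral_prod_left'

lemma exists_frequencyMass_le (f : Ultradistribution d M) (χ : UltraD d M)
    {φ : Sp d → ℂ} (hφ : IsGelfandShilov M φ) {ω : Sp d × Sp d → ℝ}
    (hω : IsModerateWeight M ω) : ∃ h : ℝ, 0 < h ∧ ∃ C a : ℝ, 0 ≤ C ∧ 0 ≤ a ∧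
      ∀ ξ, frequencyMass f χ φ hφ ω h ξ ≤ ENNReal.ofReal (C * M.wt (a * ‖ξ‖)) := by
  obtain ⟨C₀, a, hC₀, ha, hV⟩ := exists_norm_localize_stftAtom_le f χ hφ
  obtain ⟨C₁, hC₁, hω₁⟩ := hω.exists_le_mul
  obtain ⟨C₂, hC₂, hω₂⟩ := hω.exists_unitBallSup_le
  obtain ⟨C₃, h, hC₃, hh, hw₃⟩ := M.exists_wt_mul_wt_le zero_le_two zero_le_one
  obtain ⟨C₄, b, hC₄, hb, hw₄⟩ := M.exists_wt_mul_wt_le ha.le zero_le_two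
  have h00 := hω.nonneg (0, 0)
  set I : ℝ := ∫ x : Sp d, (M.wt (1 * ‖x‖))⁻¹ with hI
  have hI0 : 0 ≤ I := MeasureTheory.integral_nonneg fun x => inv_nonneg.2 (M.wt_pos _).le
  set D : ℝ := C₀ * C₂ * C₁ * C₃ * C₄ * ω (0, 0) with hD
  have hD0 : 0 ≤ D := by positivity
  refine ⟨h, hh, D * I, b, by positivity, hb.le, fun ξ => ?_⟩
  have hpt : ∀ x, ENNReal.ofReal (M.wt (h * ‖x‖))⁻¹ *
      (‖localize f χ (stftAtom φ hφ x ξ)‖ₑ * unitBallSup ω (x, ξ)) ≤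
      ENNReal.ofReal (D * M.wt (b * ‖ξ‖) * (M.wt (1 * ‖x‖))⁻¹) := by
    intro x
    have p1 := M.wt_pos (h * ‖x‖)
    have p2 := M.wt_pos (1 * ‖x‖)
    have p3 := M.wt_pos (2 * ‖x‖)
    have p4 := M.wt_pos (2 * ‖ξ‖)
    have p5 := M.wt_pos (a * ‖ξ‖)
    have h1 := inv_mul_le_mul_inv_of_mul_le p2 p1 (hw₃ ‖x‖ (norm_nonneg _))
    have h2 := hω₁ x 0 ξ 0
    rw [sub_zero, sub_zero] at h2
    have hxξ := hω.nonneg (x, ξ)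
    calc _ ≤ ENNReal.ofReal (M.wt (h * ‖x‖))⁻¹ *
          (ENNReal.ofReal (C₀ * M.wt (a * ‖ξ‖)) * ENNReal.ofReal (C₂ * ω (x, ξ))) := by
          gcongr
          · rw [← ofReal_norm]
            exact ENNReal.ofReal_le_ofReal (hV x ξ)
          · exact hω₂ _
      _ = ENNReal.ofReal ((M.wt (h * ‖x‖))⁻¹ * (C₀ * M.wt (a * ‖ξ‖) * (C₂ * ω (x, ξ)))) := by
          rw [← ENNReal.ofReal_mul (by positivity), ← ENNReal.ofReal_mul (by positivity)]
      _ ≤ _ := by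
          refine ENNReal.ofReal_le_ofReal ?_
          calc (M.wt (h * ‖x‖))⁻¹ * (C₀ * M.wt (a * ‖ξ‖) * (C₂ * ω (x, ξ)))
              ≤ (M.wt (h * ‖x‖))⁻¹ * (C₀ * M.wt (a * ‖ξ‖) *
                (C₂ * (C₁ * M.wt (2 * ‖x‖) * M.wt (2 * ‖ξ‖) * ω (0, 0)))) := by gcongr
            _ = (C₀ * C₂ * C₁ * ω (0, 0)) * ((M.wt (h * ‖x‖))⁻¹ * M.wt (2 * ‖x‖)) *
                (M.wt (a * ‖ξ‖) * M.wt (2 * ‖ξ‖)) := by ring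
            _ ≤ (C₀ * C₂ * C₁ * ω (0, 0)) * (C₃ * (M.wt (1 * ‖x‖))⁻¹) *
                (C₄ * M.wt (b * ‖ξ‖)) :=
              mul_le_mul (mul_le_mul_of_nonneg_left h1 (by positivity))
                (hw₄ ‖ξ‖ (norm_nonneg _)) (by positivity) (by positivity)
            _ = _ := by rw [hD]; ring
  have hpos : 0 ≤ D * M.wt (b * ‖ξ‖) := mul_nonneg hD0 (M.wt_pos _).le
  refine (MeasureTheory.lintegral_mono hpt).trans (le_of_eq ?_)
  rw [← MeasureTheory.ofReal_integral_eq_lintegral_ofReal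
    ((M.integrable_inv_wt one_pos).const_mul _)
    (Filter.Eventually.of_forall fun x => mul_nonneg hpos (inv_nonneg.2 (M.wt_pos _).le)),
    MeasureTheory.integral_const_mul, ← hI]
  congr 1
  ring

lemma norm_stft (f : Ultradistribution d M) (χ : UltraD d M) {φ : Sp d → ℂ}
    (hφ : IsGelfandShilov M φ) (x ξ : Sp d) :
    ‖stft φ hφ (localize f χ) x ξ‖ =
      (2 * Real.pi) ^ (-(d : ℝ) / 2) * ‖localize f χ (stftAtom φ hφ x ξ)‖ := by
  rw [stft, norm_mul, Complex.norm_real, Real.norm_of_nonneg (by positivity)]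

/-- Hölder's inequality in `x` bounds the weighted `L¹` norm by every `L^p` norm. -/
lemma exists_frequencyMass_le_eLpNorm (f : Ultradistribution d M) (χ : UltraD d M)
    {φ : Sp d → ℂ} (hφ : IsGelfandShilov M φ) {ω : Sp d × Sp d → ℝ}
    (hω : IsModerateWeight M ω) {h : ℝ} (hh : 0 < h) {p : ℝ≥0∞} (hp : 1 ≤ p) :
    ∃ C : ℝ≥0, ∀ ξ, frequencyMass f χ φ hφ ω h ξ ≤ C * MeasureTheory.eLpNorm
      (fun x => stft φ hφ (localize f χ) x ξ * (ω (x, ξ) : ℂ)) p MeasureTheory.volume := by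
  obtain ⟨C₂, hC₂, hω₂⟩ := hω.exists_unitBallSup_le
  have hpc : 1 ≤ p.conjExponent := by rw [ENNReal.conjExponent]; exact le_self_add
  have : ENNReal.HolderConjugate p p.conjExponent := ENNReal.HolderConjugate.conjExponent hp
  set c : ℝ := (2 * Real.pi) ^ (-(d : ℝ) / 2) with hc
  have hcpos : 0 < c := by positivity
  set v : Sp d → ℝ := fun x => (M.wt (h * ‖x‖))⁻¹ with hv
  have hv0 : ∀ x, 0 ≤ v x := fun x => inv_nonneg.2 (M.wt_pos _).le
  have hvfin : MeasureTheory.eLpNorm v p.conjExponent MeasureTheory.volume < ∞ :=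
    eLpNorm_lt_top_of_integrable_of_le_one (M.integrable_inv_wt hh) (fun x => by
      rw [Real.norm_of_nonneg (hv0 x)]
      exact inv_le_one_of_one_le₀ (M.one_le_wt (by positivity))) hpc
  refine ⟨(MeasureTheory.eLpNorm v p.conjExponent MeasureTheory.volume).toNNReal *
    (C₂ / c).toNNReal, fun ξ => ?_⟩
  rw [ENNReal.coe_mul, ENNReal.coe_toNNReal hvfin.ne, mul_assoc]
  set F : Sp d → ℝ := fun x =>
    ‖localize f χ (stftAtom φ hφ x ξ)‖ * (unitBallSup ω (x, ξ)).toReal with hF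
  have hWfin : ∀ x, unitBallSup ω (x, ξ) ≠ ∞ := fun x =>
    ((hω₂ (x, ξ)).trans_lt ENNReal.ofReal_lt_top).ne
  have hFm : Measurable F :=
    (((measurable_localize_stftAtom f χ hφ).comp measurable_prodMk_right).norm).mul
      ((measurable_unitBallSup ω).comp measurable_prodMk_right).ennreal_toReal
  have hvm : Measurable v := (M.measurable_wt_norm h hh.le).inv
  have h1 : frequencyMass f χ φ hφ ω h ξ =
      MeasureTheory.eLpNorm (v • F) 1 MeasureTheory.volume := by
    rw [MeasureTheory.eLpNorm_one_eq_lintegral_enorm, frequencyMass]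
    refine MeasureTheory.lintegral_congr fun x => ?_
    rw [Pi.smul_apply', smul_eq_mul, enorm_mul, enorm_mul, Real.enorm_of_nonneg (hv0 x),
      enorm_norm, Real.enorm_of_nonneg ENNReal.toReal_nonneg, ENNReal.ofReal_toReal (hWfin x)]
  rw [h1]
  refine (MeasureTheory.eLpNorm_smul_le_mul_eLpNorm (p := p.conjExponent) (q := p)
    hFm.aestronglyMeasurable hvm.aestronglyMeasurable).trans ?_
  gcongr
  refine MeasureTheory.eLpNorm_le_mul_eLpNorm_of_ae_le_mul
    (Filter.Eventually.of_forall fun x => ?_) p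
  have hωx := hω.nonneg (x, ξ)
  have h2 : (unitBallSup ω (x, ξ)).toReal ≤ C₂ * ω (x, ξ) :=
    ENNReal.toReal_le_of_le_ofReal (by positivity) (hω₂ _)
  rw [norm_mul (stft _ _ _ _ _), norm_stft, ← hc, Complex.norm_real, Real.norm_of_nonneg hωx, hF,
    norm_mul, norm_norm, Real.norm_of_nonneg ENNReal.toReal_nonneg]
  calc ‖localize f χ (stftAtom φ hφ x ξ)‖ * (unitBallSup ω (x, ξ)).toReal
      ≤ ‖localize f χ (stftAtom φ hφ x ξ)‖ * (C₂ * ω (x, ξ)) := by gcongr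
    _ = _ := by field_simp

/-- The decay of the Fourier coefficients absorbs the growth of a moderate weight. -/
lemma exists_norm_latticeCoeff_mul_weight_le (χ : UltraD d M) {φ₁ φ₂ : Sp d → ℂ}
    (hφ₁ : IsGelfandShilov M φ₁) (hφ₂ : IsGelfandShilov M φ₂)
    {ω : Sp d × Sp d → ℝ} (hω : IsModerateWeight M ω) {τ : ℝ} (hτ : 0 < τ)
    {h₀ h : ℝ} (hh₀ : 0 < h₀) (hh : 0 < h) :
    ∃ E : ℝ, 0 ≤ E ∧ ∀ x x' ξ k,
      ‖latticeCoeff τ (testMul χ (windowProd φ₁ φ₂ hφ₁ hφ₂ x x') : Sp d → ℂ) k‖ * ω (x, ξ) ≤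
        E * (M.wt (1 * ‖x‖))⁻¹ * ((M.wt (h * ‖latticePoint τ k‖))⁻¹ *
          ((M.wt (h₀ * ‖x'‖))⁻¹ * ω (x', ξ + latticePoint τ k))) := by
  obtain ⟨C₁, hC₁, hω₁⟩ := hω.exists_le_mul
  obtain ⟨C₂, h₂, hC₂, hh₂, hw₂⟩ := M.exists_wt_mul_wt_le (a := 4) (b := 1 + h₀)
    (by norm_num) (by positivity)
  obtain ⟨C₃, h₃, hC₃, hh₃, hw₃⟩ := M.exists_wt_mul_wt_le zero_le_two hh.le
  obtain ⟨C₄, hC₄, hcoeff⟩ :=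
    exists_norm_latticeCoeff_windowProd_le χ hφ₁ hφ₂ hτ hh₃ hh₂
  refine ⟨C₄ * C₁ * C₂ * C₂ * C₃, by positivity, fun x x' ξ k => ?_⟩
  have hc := hcoeff x x' k
  have e4 : ω (x, ξ) ≤ C₁ * (M.wt (4 * ‖x‖) * M.wt (4 * ‖x'‖)) *
      M.wt (2 * ‖latticePoint τ k‖) * ω (x', ξ + latticePoint τ k) := by
    refine (hω₁ x x' ξ (ξ + latticePoint τ k)).trans ?_
    rw [sub_add_cancel_left, norm_neg]
    have := M.wt_pos (2 * ‖latticePoint τ k‖)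
    have := hω.nonneg (x', ξ + latticePoint τ k)
    gcongr
    refine (M.wt_mono (by positivity) (b := 2 * ‖x‖ + 2 * ‖x'‖) ?_).trans
      ((M.wt_add_le (by positivity) (by positivity)).trans (le_of_eq ?_))
    · rw [← mul_add]; gcongr; exact norm_sub_le _ _
    · rw [← mul_assoc, ← mul_assoc]; norm_num
  have hωk := hω.nonneg (x', ξ + latticePoint τ k)
  generalize ‖latticeCoeff τ (testMul χ (windowProd φ₁ φ₂ hφ₁ hφ₂ x x') : Sp d → ℂ) k‖ = cf at hc ⊢
  have hρ0 : 0 ≤ ‖latticePoint τ k‖ := norm_nonneg _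
  generalize ω (x', ξ + latticePoint τ k) = w at e4 hωk ⊢
  generalize ‖latticePoint τ k‖ = ρ at hc e4 hρ0 ⊢
  have hx := M.wt_pos (1 * ‖x‖)
  have hx' := M.wt_pos (h₀ * ‖x'‖)
  have hk := M.wt_pos (h * ρ)
  have hk2 := M.wt_pos (2 * ρ)
  have hk3 := M.wt_pos (h₃ * ρ)
  have q1 := M.wt_pos (h₂ * ‖x‖)
  have q2 := M.wt_pos (h₂ * ‖x'‖)
  have q3 := M.wt_pos (4 * ‖x‖)
  have q4 := M.wt_pos (4 * ‖x'‖)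
  have e1 : (M.wt (h₂ * ‖x‖))⁻¹ * M.wt (4 * ‖x‖) ≤ C₂ * (M.wt (1 * ‖x‖))⁻¹ := by
    refine inv_mul_le_mul_inv_of_mul_le hx q1 (le_trans ?_ (hw₂ ‖x‖ (norm_nonneg _)))
    refine mul_le_mul_of_nonneg_left (M.wt_mono (by positivity) ?_) q3.le
    gcongr; linarith
  have e2 : (M.wt (h₂ * ‖x'‖))⁻¹ * M.wt (4 * ‖x'‖) ≤ C₂ * (M.wt (h₀ * ‖x'‖))⁻¹ := by
    refine inv_mul_le_mul_inv_of_mul_le hx' q2 (le_trans ?_ (hw₂ ‖x'‖ (norm_nonneg _)))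
    refine mul_le_mul_of_nonneg_left (M.wt_mono (by positivity) ?_) q4.le
    gcongr; linarith
  have e3 : (M.wt (h₃ * ρ))⁻¹ * M.wt (2 * ρ) ≤ C₃ * (M.wt (h * ρ))⁻¹ :=
    inv_mul_le_mul_inv_of_mul_le hk hk3 (hw₃ ρ hρ0)
  calc cf * ω (x, ξ)
      ≤ (C₄ * (M.wt (h₂ * ‖x‖))⁻¹ * (M.wt (h₂ * ‖x'‖))⁻¹ * (M.wt (h₃ * ρ))⁻¹) *
        (C₁ * (M.wt (4 * ‖x‖) * M.wt (4 * ‖x'‖)) * M.wt (2 * ρ) * w) :=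
        mul_le_mul hc e4 (hω.nonneg _) (by positivity)
    _ = C₄ * C₁ * (((M.wt (h₂ * ‖x‖))⁻¹ * M.wt (4 * ‖x‖)) *
        ((M.wt (h₂ * ‖x'‖))⁻¹ * M.wt (4 * ‖x'‖)) * ((M.wt (h₃ * ρ))⁻¹ * M.wt (2 * ρ))) * w := by
        ring
    _ ≤ C₄ * C₁ * ((C₂ * (M.wt (1 * ‖x‖))⁻¹) * (C₂ * (M.wt (h₀ * ‖x'‖))⁻¹) *
        (C₃ * (M.wt (h * ρ))⁻¹)) * w := by
        refine mul_le_mul_of_nonneg_right (mul_le_mul_of_nonneg_left ?_ (by positivity)) hωk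
        exact mul_le_mul (mul_le_mul e1 e2 (by positivity) (by positivity)) e3
          (by positivity) (by positivity)
    _ = _ := by ring

lemma enorm_mul_mul_ofReal_le {z V : ℂ} {w w' A B D : ℝ} {W : ℝ≥0∞} (hA : 0 ≤ A) (hB : 0 ≤ B)
    (hD : 0 ≤ D) (h : ‖z‖ * w ≤ A * (B * (D * w'))) (hW : ENNReal.ofReal w' ≤ W) :
    ‖z * V‖ₑ * ENNReal.ofReal w ≤
      ENNReal.ofReal A * (ENNReal.ofReal B * (ENNReal.ofReal D * (‖V‖ₑ * W))) := by
  rw [enorm_mul, mul_right_comm, ← ofReal_norm z, ← ENNReal.ofReal_mul (norm_nonneg _)]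
  refine (mul_le_mul_left (ENNReal.ofReal_le_ofReal h) _).trans ?_
  rw [ENNReal.ofReal_mul hA, ENNReal.ofReal_mul hB, ENNReal.ofReal_mul hD, mul_assoc, mul_assoc,
    mul_assoc, mul_comm (ENNReal.ofReal w')]
  gcongr

lemma enorm_integral_tsum_mul_le {α ι : Type*} [MeasurableSpace α] [Countable ι]
    {μ : MeasureTheory.Measure α} {F : α → ι → ℂ} {g : ι → α → ℝ≥0∞} {A : ι → ℝ≥0∞}
    {w K : ℝ≥0∞} (hw : w ≠ ∞) (hK : K ≠ ∞) (hA : ∀ k, A k ≠ ∞) (hg : ∀ k, Measurable (g k))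
    (h : ∀ x k, ‖F x k‖ₑ * w ≤ K * (A k * g k x)) :
    ‖∫ x, ∑' k, F x k ∂μ‖ₑ * w ≤ K * ∑' k, A k * ∫⁻ x, g k x ∂μ := by
  calc ‖∫ x, ∑' k, F x k ∂μ‖ₑ * w
      ≤ (∫⁻ x, ∑' k, ‖F x k‖ₑ ∂μ) * w :=
        mul_le_mul_left ((MeasureTheory.enorm_integral_le_lintegral_enorm _).trans
          (MeasureTheory.lintegral_mono fun x => enorm_tsum_le_tsum_enorm)) _
    _ = ∫⁻ x, ∑' k, ‖F x k‖ₑ * w ∂μ := by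
        rw [← MeasureTheory.lintegral_mul_const' _ _ hw]
        simp only [ENNReal.tsum_mul_right]
    _ ≤ ∫⁻ x, ∑' k, K * (A k * g k x) ∂μ :=
        MeasureTheory.lintegral_mono fun x => ENNReal.tsum_le_tsum (h x)
    _ = K * ∑' k, A k * ∫⁻ x, g k x ∂μ := by
        simp only [ENNReal.tsum_mul_left]
        rw [MeasureTheory.lintegral_const_mul' _ _ hK,
          MeasureTheory.lintegral_tsum fun k => ((hg k).const_mul _).aemeasurable]
        simp only [MeasureTheory.lintegral_const_mul' _ _ (hA _)]

lemma enorm_mul_ofReal_le_of_enorm_mul_le {s v N : ℂ} {c E w y : ℝ} {S : ℝ≥0∞} (hN : 0 < ‖N‖)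
    (hc : 0 < c) (hw : 0 ≤ w) (hs : ‖s‖ = c * ‖v‖)
    (h : ‖N * v‖ₑ * ENNReal.ofReal w ≤ ENNReal.ofReal (E * y) * S) :
    ‖s * (w : ℂ)‖ₑ ≤ S * ENNReal.ofReal (c * ‖N‖⁻¹ * E * y) := by
  have e : ‖s * (w : ℂ)‖ₑ =
      ENNReal.ofReal (c * ‖N‖⁻¹) * (‖N * v‖ₑ * ENNReal.ofReal w) := by
    rw [← ofReal_norm, ← ofReal_norm, norm_mul, hs, Complex.norm_real,
      Real.norm_of_nonneg hw, norm_mul, ← ENNReal.ofReal_mul (by positivity),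
      ← ENNReal.ofReal_mul (by positivity)]
    congr 1
    field_simp
  rw [e, mul_assoc (c * ‖N‖⁻¹), ENNReal.ofReal_mul (p := c * ‖N‖⁻¹) (by positivity),
    mul_left_comm S, mul_comm S]
  exact mul_le_mul_right h _

/-- The pointwise consequence of the change of window: the transform of `χ² f` with window `φ₂` is
bounded by a discrete convolution, in the frequency, of the transform of `χ f` with window `φ₁`. -/
lemma exists_enorm_stft_mul_le (f : Ultradistribution d M) (χ : UltraD d M) {φ₁ φ₂ : Sp d → ℂ}
    (hφ₁ : IsGelfandShilov M φ₁) (hφ₂ : IsGelfandShilov M φ₂) (h0 : φ₁ ≠ 0)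
    {ω : Sp d × Sp d → ℝ} (hω : IsModerateWeight M ω) {τ R : ℝ} (hτ : 0 < τ)
    (hR : R < Real.pi / τ) (hχ : tsupport (χ : Sp d → ℂ) ⊆ Metric.closedBall 0 R)
    {h₀ h : ℝ} (hh₀ : 0 < h₀) (hh : 0 < h) :
    ∃ C : ℝ, 0 ≤ C ∧ ∀ x ξ,
      ‖stft φ₂ hφ₂ (localize f (testMul χ ⟨χ, χ.2.1⟩)) x ξ * (ω (x, ξ) : ℂ)‖ₑ ≤
        (∑' k : Fin d → ℤ, ENNReal.ofReal (M.wt (h * ‖latticePoint τ k‖))⁻¹ *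
          frequencyMass f χ φ₁ hφ₁ ω h₀ (ξ + latticePoint τ k)) *
        ENNReal.ofReal (C * (M.wt (1 * ‖x‖))⁻¹) := by
  obtain ⟨E, hE0, hE⟩ := exists_norm_latticeCoeff_mul_weight_le χ hφ₁ hφ₂ hω hτ hh₀ hh
  have hN0 : 0 < ‖∫ z, φ₁ z * conj (φ₁ z)‖ :=
    norm_pos_iff.2 (hφ₁.integral_mul_conj_ne_zero h0)
  have hcpos : (0 : ℝ) < (2 * Real.pi) ^ (-(d : ℝ) / 2) := by positivity
  refine ⟨(2 * Real.pi) ^ (-(d : ℝ) / 2) * ‖∫ z, φ₁ z * conj (φ₁ z)‖⁻¹ * E,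
    mul_nonneg (mul_nonneg hcpos.le (inv_nonneg.2 hN0.le)) hE0, fun x ξ => ?_⟩
  refine enorm_mul_ofReal_le_of_enorm_mul_le hN0 hcpos (hω.nonneg (x, ξ))
    (norm_stft f (testMul χ ⟨χ, χ.2.1⟩) hφ₂ x ξ) ?_
  rw [integral_mul_localize_stftAtom f χ hφ₁ hφ₂ hτ hR hχ x ξ]
  refine enorm_integral_tsum_mul_le (A := fun k => ENNReal.ofReal (M.wt (h * ‖latticePoint τ k‖))⁻¹)
    (g := fun k x' => ENNReal.ofReal (M.wt (h₀ * ‖x'‖))⁻¹ *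
      (‖localize f χ (stftAtom φ₁ hφ₁ x' (ξ + latticePoint τ k))‖ₑ *
        unitBallSup ω (x', ξ + latticePoint τ k)))
    ENNReal.ofReal_ne_top ENNReal.ofReal_ne_top (fun k => ENNReal.ofReal_ne_top)
    (fun k => ?_) fun x' k => ?_
  · exact (M.measurable_wt_norm h₀ hh₀.le).inv.ennreal_ofReal.mul
      (((measurable_localize_stftAtom f χ hφ₁).comp measurable_prodMk_right).enorm.mul
        ((measurable_unitBallSup ω).comp measurable_prodMk_right))
  · exact enorm_mul_mul_ofReal_le (mul_nonneg hE0 (inv_nonneg.2 (M.wt_pos _).le))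
      (inv_nonneg.2 (M.wt_pos _).le) (inv_nonneg.2 (M.wt_pos _).le) (hE x x' ξ k)
      (le_unitBallSup ω (x', ξ + latticePoint τ k))

/-- Squaring the cutoff transfers regular directions from one exponent and window to any other. -/
lemma mem_regularDirections_testMul_self (f : Ultradistribution d M) (χ : UltraD d M)
    {φ₁ φ₂ : Sp d → ℂ} (hφ₁ : IsGelfandShilov M φ₁) (hφ₂ : IsGelfandShilov M φ₂) (h0 : φ₁ ≠ 0)
    {ω : Sp d × Sp d → ℝ} (hω : IsModerateWeight M ω) {p₁ p₂ q : ℝ≥0∞} (hp₁ : 1 ≤ p₁)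
    (hp₂ : 1 ≤ p₂) (hq : 1 ≤ q) {ξ₀ : Sp d}
    (hξ₀ : ξ₀ ∈ regularDirections p₁ q ω φ₁ hφ₁ (localize f χ)) :
    ξ₀ ∈ regularDirections p₂ q ω φ₂ hφ₂ (localize f (testMul χ ⟨χ, χ.2.1⟩)) := by
  obtain ⟨hne, Γ, hΓ, hmem, hfin⟩ := hξ₀
  have hbd : IsCompact (tsupport (χ : Sp d → ℂ)) := χ.2.2
  obtain ⟨R, hR⟩ := hbd.isBounded.subset_closedBall 0
  obtain ⟨τ, hτ, hRτ⟩ : ∃ τ : ℝ, 0 < τ ∧ R < Real.pi / τ := by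
    refine ⟨Real.pi / (|R| + 1), by positivity, ?_⟩
    rw [div_div_cancel₀ Real.pi_ne_zero]
    linarith [le_abs_self R]
  obtain ⟨h₀, hh₀, C, a, hC, ha, hgrowth⟩ := exists_frequencyMass_le f χ hφ₁ hω
  obtain ⟨C₁, hC₁⟩ := exists_frequencyMass_le_eLpNorm f χ hφ₁ hω hh₀ hp₁
  have hG : MeasureTheory.eLpNorm (frequencyMass f χ φ₁ hφ₁ ω h₀) q
      (MeasureTheory.volume.restrict Γ) < ∞ := by
    refine lt_of_le_of_lt (MeasureTheory.eLpNorm_le_mul_eLpNorm_of_ae_le_mul' (c := C₁)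
      (Filter.Eventually.of_forall fun ξ => ?_) q) (ENNReal.mul_lt_top ENNReal.coe_lt_top hfin)
    simpa only [enorm_eq_self] using hC₁ ξ
  obtain ⟨Γ', hΓ', hmem', h, hh, hS⟩ := exists_cone_eLpNorm_tsum_lt_top M hτ hq hΓ hmem
    (measurable_frequencyMass f χ hφ₁ ω hh₀.le) hC ha hgrowth hG
  obtain ⟨C₂, hC₂, hpt⟩ :=
    exists_enorm_stft_mul_le f χ hφ₁ hφ₂ h0 hω hτ hRτ hR hh₀ hh
  refine ⟨hne, Γ', hΓ', hmem', ?_⟩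
  set g : Sp d → ℝ≥0∞ := fun x => ENNReal.ofReal (C₂ * (M.wt (1 * ‖x‖))⁻¹) with hg
  have hgm : Measurable g := ((M.measurable_wt_norm 1 zero_le_one).inv.const_mul C₂).ennreal_ofReal
  have hgfin : MeasureTheory.eLpNorm g p₂ MeasureTheory.volume < ∞ := by
    have h1 := eLpNorm_lt_top_of_integrable_of_le_one (M.integrable_inv_wt (d := d) one_pos)
      (fun x => by
        rw [Real.norm_of_nonneg (inv_nonneg.2 (M.wt_pos _).le)]
        exact inv_le_one_of_one_le₀ (M.one_le_wt (by positivity))) hp₂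
    refine lt_of_le_of_lt (MeasureTheory.eLpNorm_le_mul_eLpNorm_of_ae_le_mul' (c := C₂.toNNReal)
      (Filter.Eventually.of_forall fun x => ?_) p₂) (ENNReal.mul_lt_top ENNReal.coe_lt_top h1)
    rw [enorm_eq_self, Real.enorm_of_nonneg (inv_nonneg.2 (M.wt_pos _).le)]
    exact (ENNReal.ofReal_mul hC₂).le
  refine lt_of_le_of_lt (MeasureTheory.eLpNorm_le_mul_eLpNorm_of_ae_le_mul'
    (c := (MeasureTheory.eLpNorm g p₂ MeasureTheory.volume).toNNReal)
    (Filter.Eventually.of_forall fun ξ => ?_) q) (ENNReal.mul_lt_top ENNReal.coe_lt_top hS)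
  rw [ENNReal.coe_toNNReal hgfin.ne, enorm_eq_self, enorm_eq_self, mul_comm]
  exact MeasureTheory.eLpNorm_le_mul_eLpNorm_of_ae_le_mul'' p₂ hgm.aestronglyMeasurable
    (Filter.Eventually.of_forall fun x => by rw [enorm_eq_self]; exact hpt x ξ)

lemma waveFrontSet_subset (f : Ultradistribution d M) {φ₁ φ₂ : Sp d → ℂ}
    (hφ₁ : IsGelfandShilov M φ₁) (hφ₂ : IsGelfandShilov M φ₂) (h0 : φ₁ ≠ 0)
    {ω : Sp d × Sp d → ℝ} (hω : IsModerateWeight M ω) {p₁ p₂ q : ℝ≥0∞} (hp₁ : 1 ≤ p₁)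
    (hp₂ : 1 ≤ p₂) (hq : 1 ≤ q) :
    waveFrontSet p₂ q ω φ₂ hφ₂ f ⊆ waveFrontSet p₁ q ω φ₁ hφ₁ f := by
  rintro z ⟨hz, hz'⟩
  refine ⟨hz, fun χ hχ => ⟨hz, fun hreg => ?_⟩⟩
  exact (hz' (testMul χ ⟨χ, χ.2.1⟩) (mul_ne_zero hχ hχ)).2
    (mem_regularDirections_testMul_self f χ hφ₁ hφ₂ h0 hω hp₁ hp₂ hq hreg)

end UltraWF

end

theorem mainTheorem4 (d : ℕ) (M : UltraWF.WeightSequence)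
    (ω : UltraWF.Sp d × UltraWF.Sp d → ℝ) (hω : UltraWF.IsModerateWeight M ω)
    (f : UltraWF.Ultradistribution d M)
    (q : ℝ≥0∞) (hq : 1 ≤ q)
    (p₁ p₂ : ℝ≥0∞) (hp₁ : 1 ≤ p₁) (hp₂ : 1 ≤ p₂)
    (φ₁ φ₂ : UltraWF.Sp d → ℂ)
    (hφ₁ : UltraWF.IsGelfandShilov M φ₁) (hφ₂ : UltraWF.IsGelfandShilov M φ₂)
    (hφ₁0 : φ₁ ≠ 0) (hφ₂0 : φ₂ ≠ 0) :
    UltraWF.waveFrontSet p₁ q ω φ₁ hφ₁ f = UltraWF.waveFrontSet p₂ q ω φ₂ hφ₂ f :=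
  Set.Subset.antisymm
    (UltraWF.waveFrontSet_subset f hφ₂ hφ₁ hφ₂0 hω hp₂ hp₁ hq)
    (UltraWF.waveFrontSet_subset f hφ₁ hφ₂ hφ₁0 hω hp₁ hp₂ hq)
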